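/- Let $X$ be the set of finitely supported sequences of integers, and for $x,y\in X$ put $\rho(x,y)=\log(1+\|x-y\|_\infty)$. Graphs are regular of positive degree and may have self-loops (each contributing $1$ to the degree) and multiple edges; the normalized adjacency matrix $A_G$ of a $d$-regular graph $G$ has as its $(u,v)$ entry the number of edges joining $u$ and $v$, divided by $d$. For an $n\times n$ real matrix $A=(a_{ij})$ let $\gamma_+(A,\rho^2)\in[0,\infty]$ be the infimum of all real $c\ge 0$ such that $$\frac1{n^2}\sum_{i,j=1}^n\rho(x_i,y_j)^2\le \frac{c}{n}\sum_{i,j=1}^n a_{ij}\,\rho(x_i,y_j)^2\qquad\text{for all }x_1,\dots,x_n,y_1,\dots,y_n\in X$$ ($\infty$ if there is no such $c$), and put $\gamma_+(G,\rho^2)=\gamma_+(A_G,\rho^2)$. For an integer $t\ge1$ let $\mathscr A_t(A)=\frac1t\sum_{s=0}^{t-1}A^s$, and for a $d$-regular graph $G$ let $\mathscr A_t(G)$ be the graph on the same vertices in which, for every $s\in\{0,\dots,t-1\}$ and all vertices $u,v$, one draws $d^{\,t-1-s}$ edges joining $u,v$ for every walk of length $s$ in $G$ from $u$ to $v$ (so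 that $A_{\mathscr A_t(G)}=\mathscr A_t(A_G)$). Then $(X,\rho)$ is a metric space, and there are regular graphs $G_n$ ($n\ge1$), where $G_n$ has $n$ vertices, such that (i) $\gamma_+(G_n,\rho^2)<\infty$ for every $n\ge 1$, and $\lim_{n\to\infty}\gamma_+(G_n,\rho^2)=\infty$; (ii) for every integer $t\ge1$ there is $N_0$ such that $\gamma_+(\mathscr A_t(G_n),\rho^2)\ge\frac12\,\gamma_+(G_n,\rho^2)$ for all $n>N_0$. Consequently $(X,\rho)$ has no uniform decay of the Poincaré constant. That is, the following statement is false: for every real $M>1$ there are an integer $t\ge1$ and a real $s_0\ge1$ such that for every $n\in\mathbb N$ and every symmetric stochastic $n\times n$ real matrix $A$, if $\gamma_+(A,\rho^2)\ge s_0$ then $\gamma_+(\mathscr A_t(A),\rho^2)\le\gamma_+(A,\rho^2)/M$. -/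

import Mathlib

open scoped NNReal ENNReal

noncomputable section

/-- A regular graph of positive degree on the vertex set `V`, with self-loops and multiple edges
allowed. `mult u v` is the number of edges joining `u` and `v`; `mult v v` is the number of
self-loops at `v`, and each self-loop contributes `1` to the degree of `v`. -/
structure RegularMultigraph (V : Type*) [Fintype V] where
  mult : V → V → ℕ
  mult_symm : ∀ u v, mult u v = mult v u
  deg : ℕ
  deg_pos : 0 < deg
  sum_mult : ∀ u, ∑ v, mult u v = deg

namespace RegularMultigraph

variable {V : Type*} [Fintype V] [DecidableEq V]

/-- The normalized adjacency matrix `A_G`. -/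
def normAdj (G : RegularMultigraph V) : Matrix V V ℝ :=
  Matrix.of fun u v => (G.mult u v : ℝ) / (G.deg : ℝ)

/-- The number of walks of length `s` in `G` (sequences of `s` consecutive edges, parallel edges
being distinguished) from `u` to `v`. -/
def walkCount (G : RegularMultigraph V) : ℕ → V → V → ℕ
  | 0, u, v => if u = v then 1 else 0
  | s + 1, u, v => ∑ w, G.mult u w * walkCount G s w v

lemma walkCount_eq_pow (G : RegularMultigraph V) (s : ℕ) (u v : V) :
    G.walkCount s u v = (Matrix.of G.mult ^ s) u v := by
  induction s generalizing u with
  | zero => simp [walkCount, Matrix.one_apply]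
  | succ s ih => simp [walkCount, pow_succ', Matrix.mul_apply, ih]

lemma walkCount_symm (G : RegularMultigraph V) (s : ℕ) (u v : V) :
    G.walkCount s u v = G.walkCount s v u := by
  have h : (Matrix.of G.mult).transpose = Matrix.of G.mult := by
    ext a b
    exact G.mult_symm b a
  rw [walkCount_eq_pow, walkCount_eq_pow]
  conv_lhs => rw [← h, ← Matrix.transpose_pow]
  rfl

lemma sum_walkCount (G : RegularMultigraph V) (s : ℕ) (u : V) :
    ∑ v, G.walkCount s u v = G.deg ^ s := by
  induction s generalizing u with
  | zero => simp [walkCount]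
  | succ s ih =>
    simp only [walkCount]
    rw [Finset.sum_comm]
    simp_rw [← Finset.mul_sum, ih, ← Finset.sum_mul, G.sum_mult]
    rw [pow_succ']

/-- The Cesàro graph `𝒜_m(G)`: on the same vertices, for every `s ∈ {0, …, m - 1}` and all `u, v`,
draw `deg ^ (m - 1 - s)` edges joining `u, v` for every walk of length `s` from `u` to `v`.
It is regular of degree `m * deg ^ (m - 1)`. -/
def cesaro (G : RegularMultigraph V) (m : ℕ) (hm : 0 < m) : RegularMultigraph V where
  mult u v := ∑ s ∈ Finset.range m, G.deg ^ (m - 1 - s) * G.walkCount s u v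
  mult_symm u v := by
    simp_rw [G.walkCount_symm _ u v]
  deg := m * G.deg ^ (m - 1)
  deg_pos := Nat.mul_pos hm (pow_pos G.deg_pos _)
  sum_mult u := by
    rw [Finset.sum_comm]
    simp_rw [← Finset.mul_sum, G.sum_walkCount]
    rw [Finset.sum_congr rfl (g := fun _ => G.deg ^ (m - 1))]
    · simp
    · intro s hs
      rw [← pow_add]
      congr 1
      have := Finset.mem_range.1 hs
      omega

end RegularMultigraph

/-- The Cesàro average `𝒜_m(A) = (1/m) ∑_{s<m} A ^ s` of a square matrix. -/
def cesaroMatrix {V : Type*} [Fintype V] [DecidableEq V] (m : ℕ) (A : Matrix V V ℝ) :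
    Matrix V V ℝ :=
  (1 / (m : ℝ)) • ∑ s ∈ Finset.range m, A ^ s

/-- The normalized adjacency matrix of `𝒜_m(G)` is the Cesàro average of that of `G`. -/
lemma RegularMultigraph.normAdj_cesaro {V : Type*} [Fintype V] [DecidableEq V]
    (G : RegularMultigraph V) (m : ℕ) (hm : 0 < m) :
    (G.cesaro m hm).normAdj = cesaroMatrix m G.normAdj := by
  have hd : (G.deg : ℝ) ≠ 0 := by exact_mod_cast G.deg_pos.ne'
  have hm' : (m : ℝ) ≠ 0 := by exact_mod_cast hm.ne'
  have key : ∀ (s : ℕ) (u v : V),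
      (G.normAdj ^ s) u v = (G.walkCount s u v : ℝ) / (G.deg : ℝ) ^ s := by
    intro s
    induction s with
    | zero => intro u v; simp [RegularMultigraph.walkCount, Matrix.one_apply]
    | succ s ih =>
      intro u v
      rw [pow_succ', Matrix.mul_apply]
      simp only [ih]
      simp only [RegularMultigraph.normAdj, Matrix.of_apply, RegularMultigraph.walkCount]
      push_cast
      rw [Finset.sum_div]
      refine Finset.sum_congr rfl fun w _ => ?_
      field_simp
      ring
  ext u v
  simp only [cesaroMatrix, Matrix.smul_apply, Matrix.sum_apply, key, smul_eq_mul]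
  simp only [RegularMultigraph.normAdj, RegularMultigraph.cesaro, Matrix.of_apply]
  push_cast
  rw [Finset.sum_div, Finset.mul_sum]
  refine Finset.sum_congr rfl fun s hs => ?_
  have hs' := Finset.mem_range.1 hs
  have : (G.deg : ℝ) ^ (m - 1) = (G.deg : ℝ) ^ (m - 1 - s) * (G.deg : ℝ) ^ s := by
    rw [← pow_add]
    congr 1
    omega
  rw [this]
  field_simp

/-- The Poincaré constant `γ₊(A, K)`: the infimum over all real `c ≥ 0` with
`(1/n²) ∑ᵢⱼ K(xᵢ, yⱼ) ≤ (c/n) ∑ᵢⱼ aᵢⱼ K(xᵢ, yⱼ)` for all `x, y : V → X`, where `n = |V|`.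
It equals `∞` when there is no such `c`. -/
def poincarePlus {V X : Type*} [Fintype V] (A : Matrix V V ℝ) (K : X → X → ℝ) : ℝ≥0∞ :=
  ⨅ (c : ℝ≥0) (_ : ∀ x y : V → X,
      1 / (Fintype.card V : ℝ) ^ 2 * ∑ i, ∑ j, K (x i) (y j) ≤
        (c : ℝ) / (Fintype.card V : ℝ) * ∑ i, ∑ j, A i j * K (x i) (y j)), (c : ℝ≥0∞)

/-- `A` is symmetric and stochastic. -/
def IsSymmStochastic {V : Type*} [Fintype V] [DecidableEq V] (A : Matrix V V ℝ) : Prop :=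
  A.IsSymm ∧ A ∈ Matrix.rowStochastic ℝ V

/-- Uniform decay of the Poincaré constant of the kernel `K` under Cesàro averaging. -/
def UniformDecay {X : Type*} (K : X → X → ℝ) : Prop :=
  ∀ M : ℝ, 1 < M → ∃ t : ℕ, 0 < t ∧ ∃ s₀ : ℝ, 1 ≤ s₀ ∧
    ∀ (n : ℕ) (A : Matrix (Fin n) (Fin n) ℝ), IsSymmStochastic A →
      ENNReal.ofReal s₀ ≤ poincarePlus A K →
        poincarePlus (cesaroMatrix t A) K ≤ poincarePlus A K / ENNReal.ofReal M

/-- The norm `‖x‖_∞` of a finitely supported integer sequence. -/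
def supNorm (x : ℕ →₀ ℤ) : ℝ := ⨆ i, |(x i : ℝ)|

/-- The supremum defining `supNorm` is over a bounded set. -/
lemma bddAbove_supNorm (x : ℕ →₀ ℤ) : BddAbove (Set.range fun i => |(x i : ℝ)|) := by
  refine ⟨∑ i ∈ x.support, |(x i : ℝ)|, ?_⟩
  rintro _ ⟨i, rfl⟩
  by_cases h : i ∈ x.support
  · exact Finset.single_le_sum (f := fun i => |(x i : ℝ)|) (fun _ _ => abs_nonneg _) h
  · have h0 : x i = 0 := by simpa using h
    simpa [h0] using Finset.sum_nonneg (s := x.support) fun i _ => abs_nonneg (x i : ℝ)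

end

/-!
The graphs are obtained from expanders by averaging them, for as long as averaging helps.

Write `γ` for the Poincaré constant with respect to the square of `ρ = log (1 + ‖x - y‖_∞)`. Two
facts about an expander `H` on `n` vertices of logarithmic degree are needed.

* `γ(H) = O((log log n) ^ 2)` (`poincarePlus_logDist_le`). If `l ^ 2` is the average of `ρ ^ 2` over
  the edges, then most edges have `ρ`-length `O(l)`. Deleting the others leaves an expander on most
  of the vertices, in which balls grow exponentially, so that a quarter of the vertices lies within
  `O(log n)` short edges of one vertex `p`. Since `ρ` is logarithmic, these vertices are at
  `ρ`-distance `O(l log log n)` from `p`. The Poincaré inequality for real-valued functions, applied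
  to the excess of `ρ(p, ·)` over this radius, takes care of the remaining vertices.
* If the edges of `G` join vertices at distance at most `S` in `H`, then `γ(G)` is at least of the
  order of `(log log n / log (1 + S)) ^ 2` (`RegularMultigraph.le_poincarePlus_logDist`): embed the
  graph distance of `H` isometrically into `ℓ_∞`, and note that most distances in `H` are at least
  a power of `log n`.

Starting from `H`, replace the current graph by its Cesàro average over some `t ≤ T` steps whenever
this reduces `γ` by more than a factor `2` (`exists_stable_or_small`). After `k` replacements `γ` is
at most `2 ^ (-k) γ(H)`, whereas `S ≤ T ^ k`, so that `γ` is still at least of the order of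
`(log log n / (k log T)) ^ 2`. For fixed `T` and large `n` these bounds are incompatible once `k` is
a suitable multiple of `log log log n`, so the procedure stops with a graph for which averaging over
at most `T` steps at most halves `γ`, and whose `γ` is as large as desired. Letting `T` tend to infinity
slowly with `n` gives the sequence of graphs.

The expanders are Cayley graphs of `Fin n` with random generators, which exist for every `n`.
-/

/-! ### The metric `log (1 + ‖x - y‖_∞)` -/

/-- The `ℓ_∞` distance of two finitely supported integer sequences, as a natural number. -/
noncomputable def natDist (x y : ℕ →₀ ℤ) : ℕ := (x - y).support.sup fun i => ((x - y) i).natAbs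

lemma natDist_le_iff {x y : ℕ →₀ ℤ} {k : ℕ} : natDist x y ≤ k ↔ ∀ i, (x i - y i).natAbs ≤ k := by
  unfold natDist
  rw [Finset.sup_le_iff]
  refine ⟨fun h i => ?_, fun h i _ => by simpa using h i⟩
  by_cases hi : i ∈ (x - y).support
  · simpa using h i hi
  · have : x i - y i = 0 := by simpa using hi
    simp [this]

lemma natAbs_sub_le_natDist (x y : ℕ →₀ ℤ) (i : ℕ) : (x i - y i).natAbs ≤ natDist x y :=
  natDist_le_iff.1 le_rfl i

lemma supNorm_sub (x y : ℕ →₀ ℤ) : supNorm (x - y) = natDist x y := by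
  apply le_antisymm
  · refine ciSup_le fun i => ?_
    have h := natAbs_sub_le_natDist x y i
    rw [Finsupp.sub_apply, ← Int.cast_abs, Int.abs_eq_natAbs, Int.cast_natCast]
    exact_mod_cast h
  · have h : natDist x y ≤ ⌊supNorm (x - y)⌋₊ := by
      refine natDist_le_iff.2 fun i => Nat.le_floor ?_
      have := le_ciSup (bddAbove_supNorm (x - y)) i
      rwa [Finsupp.sub_apply, ← Int.cast_abs, Int.abs_eq_natAbs, Int.cast_natCast] at this
    have h0 : 0 ≤ supNorm (x - y) := Real.iSup_nonneg fun _ => abs_nonneg _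
    exact (Nat.cast_le.2 h).trans (Nat.floor_le h0)

lemma natDist_self (x : ℕ →₀ ℤ) : natDist x x = 0 := by simp [natDist]

lemma natDist_comm (x y : ℕ →₀ ℤ) : natDist x y = natDist y x := by
  apply le_antisymm <;> refine natDist_le_iff.2 fun i => ?_
  · have := natAbs_sub_le_natDist y x i; omega
  · have := natAbs_sub_le_natDist x y i; omega

lemma natDist_triangle (x y z : ℕ →₀ ℤ) : natDist x z ≤ natDist x y + natDist y z := by
  refine natDist_le_iff.2 fun i => ?_
  have h1 := natAbs_sub_le_natDist x y i
  have h2 := natAbs_sub_le_natDist y z i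
  omega

lemma eq_of_natDist_eq_zero {x y : ℕ →₀ ℤ} (h : natDist x y = 0) : x = y := by
  ext i
  have := natAbs_sub_le_natDist x y i
  omega

/-- The logarithm of `1 + N` for an integer-valued distance `N`. -/
noncomputable def logDist {X : Type*} (N : X → X → ℕ) (x y : X) : ℝ := Real.log (1 + N x y)

section logDist

variable {X : Type*} {N : X → X → ℕ}

lemma logDist_nonneg (x y : X) : 0 ≤ logDist N x y :=
  Real.log_nonneg (by have : (0 : ℝ) ≤ N x y := Nat.cast_nonneg _; linarith)

lemma logDist_le_log {x y : X} {k : ℕ} (h : N x y ≤ k) : logDist N x y ≤ Real.log (1 + k) :=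
  Real.log_le_log (by positivity) (by gcongr)

lemma log_le_logDist {x y : X} {k : ℕ} (h : k ≤ N x y) : Real.log (1 + k) ≤ logDist N x y :=
  Real.log_le_log (by positivity) (by gcongr)

lemma logDist_self (h : ∀ x, N x x = 0) (x : X) : logDist N x x = 0 := by simp [logDist, h]

lemma logDist_comm (h : ∀ x y, N x y = N y x) (x y : X) : logDist N x y = logDist N y x := by
  simp [logDist, h x y]

lemma logDist_triangle (h : ∀ x y z, N x z ≤ N x y + N y z) (x y z : X) :
    logDist N x z ≤ logDist N x y + logDist N y z := by
  unfold logDist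
  rw [← Real.log_mul (by positivity) (by positivity)]
  refine Real.log_le_log (by positivity) ?_
  have h1 : (N x z : ℝ) ≤ N x y + N y z := by exact_mod_cast h x y z
  have h2 : (0 : ℝ) ≤ N x y * N y z := by positivity
  nlinarith

end logDist

/-- The metric `log (1 + ‖x - y‖_∞)` on the finitely supported integer sequences. -/
noncomputable abbrev logMetricSpace : MetricSpace (ℕ →₀ ℤ) where
  dist := logDist natDist
  dist_self := logDist_self natDist_self
  dist_comm := logDist_comm natDist_comm
  dist_triangle := logDist_triangle natDist_triangle
  eq_of_dist_eq_zero {x y} h := by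
    apply eq_of_natDist_eq_zero
    by_contra h0
    have h1 : Real.log (1 + (1 : ℕ)) ≤ logDist natDist x y :=
      log_le_logDist (Nat.one_le_iff_ne_zero.2 h0)
    have h2 : 0 < Real.log (1 + (1 : ℕ)) := Real.log_pos (by norm_num)
    exact (h2.trans_le h1).ne' h

/-! ### Expansion of a symmetric stochastic matrix with a spectral gap -/

section Expansion

variable {V : Type*} [Fintype V] [DecidableEq V] {A : Matrix V V ℝ}

lemma IsSymmStochastic.nonneg (hA : IsSymmStochastic A) (u v : V) : 0 ≤ A u v :=
  Matrix.nonneg_of_mem_rowStochastic hA.2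

lemma IsSymmStochastic.sum_row (hA : IsSymmStochastic A) (u : V) : ∑ v, A u v = 1 :=
  Matrix.sum_row_of_mem_rowStochastic hA.2 u

lemma IsSymmStochastic.symm (hA : IsSymmStochastic A) (u v : V) : A u v = A v u :=
  hA.1.apply v u

lemma IsSymmStochastic.sum_col (hA : IsSymmStochastic A) (v : V) : ∑ u, A u v = 1 := by
  simp_rw [hA.symm _ v]
  exact hA.sum_row v

/-- The Poincaré inequality with constant `C` for real-valued functions; for a symmetric stochastic
matrix it says that the second largest eigenvalue is at most `1 - 1 / C`. -/
def HasGap (A : Matrix V V ℝ) (C : ℝ) : Prop :=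
  ∀ f : V → ℝ, ∑ u, ∑ v, (f u - f v) ^ 2 ≤
    C * Fintype.card V * ∑ u, ∑ v, A u v * (f u - f v) ^ 2

/-- The quadratic form of an indicator function counts the edges leaving the set. -/
lemma sum_mul_indicator_sub_sq (B : V → V → ℝ) (hB : ∀ u v, B u v = B v u) (S : Finset V) :
    ∑ u, ∑ v, B u v * ((if u ∈ S then (1 : ℝ) else 0) - if v ∈ S then 1 else 0) ^ 2 =
      2 * ∑ u ∈ S, ∑ v ∈ Sᶜ, B u v := by
  have h : ∀ u v, B u v * ((if u ∈ S then (1 : ℝ) else 0) - if v ∈ S then 1 else 0) ^ 2 =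
      (if u ∈ S then if v ∈ Sᶜ then B u v else 0 else 0) +
        (if v ∈ S then if u ∈ Sᶜ then B v u else 0 else 0) := by
    intro u v
    by_cases hu : u ∈ S <;> by_cases hv : v ∈ S <;> simp [hu, hv, hB u v]
  have h1 : ∑ u, ∑ v, (if u ∈ S then if v ∈ Sᶜ then B u v else 0 else 0) =
      ∑ u ∈ S, ∑ v ∈ Sᶜ, B u v := by
    have h2 : ∀ u, ∑ v, (if u ∈ S then if v ∈ Sᶜ then B u v else 0 else 0) =
        if u ∈ S then ∑ v ∈ Sᶜ, B u v else 0 := fun u => by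
      split_ifs
      · rw [Finset.sum_ite_mem, Finset.univ_inter]
      · simp
    simp_rw [h2]
    rw [Finset.sum_ite_mem, Finset.univ_inter]
  simp_rw [h, Finset.sum_add_distrib]
  rw [Finset.sum_comm (f := fun u v => if v ∈ S then if u ∈ Sᶜ then B v u else 0 else 0), h1]
  ring

/-- The easy direction of Cheeger's inequality. -/
lemma HasGap.card_le (hA : IsSymmStochastic A) {C : ℝ} (hC : 0 < C) (hgap : HasGap A C)
    {S : Finset V} (hS : 2 * S.card ≤ Fintype.card V) :
    1 / (2 * C) * S.card ≤ ∑ u ∈ S, ∑ v ∈ Sᶜ, A u v := by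
  rcases S.eq_empty_or_nonempty with rfl | hne
  · simp
  have h := hgap fun u => if u ∈ S then 1 else 0
  have h1 := sum_mul_indicator_sub_sq (fun _ _ : V => (1 : ℝ)) (fun _ _ => rfl) S
  have h2 := sum_mul_indicator_sub_sq (fun u v => A u v) hA.symm S
  simp only [one_mul] at h1
  rw [h1, h2] at h
  simp only [Finset.sum_const, nsmul_eq_mul, mul_one] at h
  set e := ∑ u ∈ S, ∑ v ∈ Sᶜ, A u v
  have hcard : (S.card : ℝ) + (Sᶜ).card = Fintype.card V := by
    exact_mod_cast Finset.card_add_card_compl S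
  have hS' : 2 * (S.card : ℝ) ≤ Fintype.card V := by exact_mod_cast hS
  have hpos : (0 : ℝ) < S.card := by exact_mod_cast hne.card_pos
  set s : ℝ := (S.card : ℝ)
  set n : ℝ := (Fintype.card V : ℝ)
  have hn : 0 < n := by linarith
  have h3 : n * s ≤ n * (2 * C * e) := by nlinarith
  have h4 := le_of_mul_le_mul_left h3 hn
  rw [div_mul_eq_mul_div, one_mul, div_le_iff₀ (by positivity)]
  linarith

/-- Removing a small fraction of the edges of an expander leaves an expander on the complement
of a small set `W`. The set `W` is a largest one violating expansion. -/
lemma exists_expanding_core (hA : IsSymmStochastic A) {h : ℝ} (hh : 0 < h)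
    (hexp : ∀ S : Finset V, 2 * S.card ≤ Fintype.card V →
      h * S.card ≤ ∑ u ∈ S, ∑ v ∈ Sᶜ, A u v)
    (good : V → V → Prop) [DecidableRel good]
    (hbad : ∑ u, ∑ v, (if good u v then 0 else A u v) ≤ h / 8 * Fintype.card V) :
    ∃ W : Finset V, 4 * W.card ≤ Fintype.card V ∧
      ∀ S : Finset V, Disjoint S W → 4 * S.card ≤ Fintype.card V →
        h / 2 * S.card ≤ ∑ u ∈ S, ∑ v ∈ (S ∪ W)ᶜ, (if good u v then A u v else 0) := by
  set e : Finset V → Finset V → ℝ := fun S T => ∑ u ∈ S, ∑ v ∈ T, if good u v then A u v else 0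
    with he
  have hg0 : ∀ u v, 0 ≤ if good u v then A u v else 0 := fun u v => by
    split_ifs
    exacts [hA.nonneg u v, le_rfl]
  have he_mono : ∀ S T T' : Finset V, T ⊆ T' → e S T ≤ e S T' := fun S T T' hT =>
    Finset.sum_le_sum fun u _ => Finset.sum_le_sum_of_subset_of_nonneg hT fun v _ _ => hg0 u v
  obtain ⟨W, hW, hmax⟩ := Finset.exists_max_image
    (Finset.univ.filter fun S : Finset V => 2 * S.card ≤ Fintype.card V ∧ e S Sᶜ ≤ h / 2 * S.card)
    Finset.card ⟨∅, by simp [he]⟩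
  simp only [Finset.mem_filter, Finset.mem_univ, true_and] at hW hmax
  have hW4 : 4 * W.card ≤ Fintype.card V := by
    have h1 := hexp W hW.1
    have h2 : ∑ u ∈ W, ∑ v ∈ Wᶜ, A u v =
        e W Wᶜ + ∑ u ∈ W, ∑ v ∈ Wᶜ, (if good u v then 0 else A u v) := by
      simp only [he, ← Finset.sum_add_distrib]
      refine Finset.sum_congr rfl fun u _ => Finset.sum_congr rfl fun v _ => ?_
      split_ifs <;> simp
    have hb0 : ∀ u v, 0 ≤ if good u v then 0 else A u v := fun u v => by
      split_ifs
      exacts [le_rfl, hA.nonneg u v]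
    have h3 : ∑ u ∈ W, ∑ v ∈ Wᶜ, (if good u v then 0 else A u v) ≤
        ∑ u, ∑ v, (if good u v then 0 else A u v) :=
      (Finset.sum_le_sum fun u _ => Finset.sum_le_univ_sum_of_nonneg (hb0 u)).trans
        (Finset.sum_le_univ_sum_of_nonneg fun u => Finset.sum_nonneg fun v _ => hb0 u v)
    have h4 : h / 8 * (4 * W.card : ℝ) ≤ h / 8 * Fintype.card V := by linarith [hW.2]
    have h5 := le_of_mul_le_mul_left h4 (by positivity)
    exact_mod_cast h5
  refine ⟨W, hW4, fun S hSW hS => ?_⟩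
  rcases S.eq_empty_or_nonempty with rfl | hne
  · simp
  by_contra! hlt
  have hcard : (S ∪ W).card = S.card + W.card := Finset.card_union_of_disjoint hSW
  have h1 : e (S ∪ W) (S ∪ W)ᶜ ≤ h / 2 * (S ∪ W).card := by
    have h2 : e (S ∪ W) (S ∪ W)ᶜ = e S (S ∪ W)ᶜ + e W (S ∪ W)ᶜ := Finset.sum_union hSW
    have h3 : e W (S ∪ W)ᶜ ≤ e W Wᶜ :=
      he_mono _ _ _ (Finset.compl_subset_compl.2 Finset.subset_union_right)
    rw [h2, hcard]
    push_cast
    have h4 : e S (S ∪ W)ᶜ < h / 2 * S.card := hlt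
    linarith [hW.2]
  have h2 := hmax (S ∪ W) ⟨by omega, h1⟩
  have := hne.card_pos
  omega

/-- If the edges of length at most `q` carry most of the weight of an expander, then some ball whose
radius is `q` times a logarithm of the number of vertices contains a quarter of the vertices. -/
lemma exists_large_ball (hA : IsSymmStochastic A) {h : ℝ} (hh : 0 < h)
    (hexp : ∀ S : Finset V, 2 * S.card ≤ Fintype.card V →
      h * S.card ≤ ∑ u ∈ S, ∑ v ∈ Sᶜ, A u v) (hV : 0 < Fintype.card V)
    (N : V → V → ℕ) (hN0 : ∀ u, N u u = 0) (hN : ∀ u v w, N u w ≤ N u v + N v w) (q : ℕ)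
    (hbad : ∑ u, ∑ v, (if N u v ≤ q then 0 else A u v) ≤ h / 8 * Fintype.card V)
    {r : ℕ} (hr : (Fintype.card V : ℝ) ≤ (1 + h / 2) ^ r) :
    ∃ (p : V) (B : Finset V), Fintype.card V ≤ 4 * B.card ∧ ∀ v ∈ B, N p v ≤ r * q := by
  obtain ⟨W, hW, hexpW⟩ := exists_expanding_core hA hh hexp (fun u v => N u v ≤ q) hbad
  obtain ⟨p, hp⟩ : ∃ p, p ∉ W := by
    by_contra! hall
    have : W = Finset.univ := Finset.eq_univ_iff_forall.2 hall
    rw [this, Finset.card_univ] at hW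
    omega
  have key : ∀ k : ℕ, ∃ B : Finset V, p ∈ B ∧ Disjoint B W ∧
      (Fintype.card V ≤ 4 * B.card ∨ (1 + h / 2) ^ k ≤ (B.card : ℝ)) ∧
        ∀ v ∈ B, N p v ≤ k * q := by
    intro k
    induction k with
    | zero =>
      exact ⟨{p}, by simp, by simpa using hp, Or.inr (by simp), by simp [hN0]⟩
    | succ k ih =>
      obtain ⟨B, hpB, hBW, hcard, hB⟩ := ih
      by_cases hlarge : Fintype.card V ≤ 4 * B.card
      · exact ⟨B, hpB, hBW, Or.inl hlarge, fun v hv => (hB v hv).trans (by gcongr; omega)⟩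
      have hcard' := hcard.resolve_left hlarge
      -- the vertices outside `B ∪ W` that are joined to `B` by an edge of length at most `q`
      set T := (B ∪ W)ᶜ.filter fun v => ∃ u ∈ B, N u v ≤ q with hT
      have hTsub : ∀ v ∈ T, v ∉ B ∧ v ∉ W ∧ ∃ u ∈ B, N u v ≤ q := fun v hv => by
        simpa [hT, and_assoc] using hv
      have hBT : Disjoint B T := Finset.disjoint_right.2 fun v hv => (hTsub v hv).1
      have hTcard : h / 2 * B.card ≤ T.card := by
        refine (hexpW B hBW (by omega)).trans ?_
        rw [Finset.sum_comm]
        have h1 : ∑ v ∈ (B ∪ W)ᶜ, ∑ u ∈ B, (if N u v ≤ q then A u v else 0) =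
            ∑ v ∈ T, ∑ u ∈ B, (if N u v ≤ q then A u v else 0) := by
          rw [hT, Finset.sum_filter]
          refine Finset.sum_congr rfl fun v _ => ?_
          split_ifs with hv
          · rfl
          · push Not at hv
            exact Finset.sum_eq_zero fun u hu => if_neg (by have := hv u hu; omega)
        rw [h1, Finset.card_eq_sum_ones]
        push_cast
        refine Finset.sum_le_sum fun v _ => ?_
        rw [← hA.sum_col v]
        refine (Finset.sum_le_univ_sum_of_nonneg fun u => ?_).trans
          (Finset.sum_le_sum fun u _ => ?_)
        · split_ifs
          exacts [hA.nonneg u v, le_rfl]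
        · split_ifs
          exacts [le_rfl, hA.nonneg u v]
      refine ⟨B ∪ T, Finset.mem_union_left _ hpB, ?_, Or.inr ?_, ?_⟩
      · exact Finset.disjoint_union_left.2
          ⟨hBW, Finset.disjoint_left.2 fun v hv => (hTsub v hv).2.1⟩
      · rw [Finset.card_union_of_disjoint hBT, pow_succ]
        push_cast
        nlinarith
      · intro v hv
        rcases Finset.mem_union.1 hv with hv | hv
        · exact (hB v hv).trans (by gcongr; omega)
        · obtain ⟨-, -, u, hu, huv⟩ := hTsub v hv
          have := hN p u v
          have := hB u hu
          rw [add_mul]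
          omega
  obtain ⟨B, -, -, hcard, hB⟩ := key r
  refine ⟨p, B, ?_, hB⟩
  rcases hcard with hcard | hcard
  · exact hcard
  · have : (Fintype.card V : ℝ) ≤ B.card := hr.trans hcard
    have : Fintype.card V ≤ B.card := by exact_mod_cast this
    omega

end Expansion

/-! ### Upper bound for the Poincaré constant -/

/-- A path of `r` steps of integer length at most `q` is longer than one step by a factor of order
`log r` on the logarithmic scale. The factor is multiplicative for all `q`, as `q = 0` or
`log 2 ≤ log (1 + q)`. -/
lemma log_one_add_mul_le {r : ℕ} (hr : 0 < r) (q : ℕ) :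
    Real.log (1 + (r * q : ℕ)) ≤ (1 + Real.log r / Real.log 2) * Real.log (1 + q) := by
  have hl2 : 0 < Real.log 2 := Real.log_pos (by norm_num)
  have hr1 : (1 : ℝ) ≤ r := by exact_mod_cast hr
  have hlr : 0 ≤ Real.log r := Real.log_nonneg hr1
  rcases Nat.eq_zero_or_pos q with rfl | hq
  · simp
  have hq1 : (1 : ℝ) ≤ q := by exact_mod_cast hq
  have h1 : Real.log (1 + (r * q : ℕ)) ≤ Real.log (r * (1 + q)) := by
    refine Real.log_le_log (by positivity) ?_
    push_cast
    nlinarith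
  rw [Real.log_mul (by positivity) (by positivity)] at h1
  have h2 : Real.log 2 ≤ Real.log (1 + q) := Real.log_le_log (by norm_num) (by linarith)
  have h3 : Real.log r ≤ Real.log r / Real.log 2 * Real.log (1 + q) := by
    rw [div_mul_eq_mul_div, le_div_iff₀ hl2]
    gcongr
  linarith

lemma poincarePlus_le_of_forall {V X : Type*} [Fintype V] {A : Matrix V V ℝ} {K : X → X → ℝ} {c : ℝ}
    (hc : 0 ≤ c) (hV : 0 < Fintype.card V)
    (h : ∀ x y : V → X, ∑ i, ∑ j, K (x i) (y j) ≤
      c * Fintype.card V * ∑ i, ∑ j, A i j * K (x i) (y j)) :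
    poincarePlus A K ≤ ENNReal.ofReal c := by
  refine iInf₂_le (Real.toNNReal c) fun x y => ?_
  have hn : (0 : ℝ) < Fintype.card V := by exact_mod_cast hV
  rw [Real.coe_toNNReal c hc, div_mul_eq_mul_div, one_mul, div_mul_eq_mul_div,
    div_le_div_iff₀ (by positivity) hn]
  nlinarith [mul_le_mul_of_nonneg_right (h x y) hn.le]

section UpperBound

variable {V : Type*} [Fintype V] [DecidableEq V] {A : Matrix V V ℝ}

/-- Markov's inequality for the lengths of the edges. It holds for average zero as well, since then
all edges of positive weight have length zero. -/
lemma exists_threshold (hA : IsSymmStochastic A) (ρ : V → V → ℝ)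
    {b : ℝ} (hb : 0 < b) :
    ∃ l : ℝ, 0 ≤ l ∧ b * l ^ 2 = ∑ u, ∑ v, A u v * ρ u v ^ 2 ∧
      ∑ u, ∑ v, (if ρ u v ≤ l then 0 else A u v) ≤ b := by
  set E := ∑ u, ∑ v, A u v * ρ u v ^ 2 with hE
  have hterm : ∀ u v, 0 ≤ A u v * ρ u v ^ 2 := fun u v => mul_nonneg (hA.nonneg u v) (sq_nonneg _)
  have hE0 : 0 ≤ E := Finset.sum_nonneg fun u _ => Finset.sum_nonneg fun v _ => hterm u v
  have hl2 : b * √(E / b) ^ 2 = E := by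
    rw [Real.sq_sqrt (by positivity)]
    field_simp
  refine ⟨√(E / b), Real.sqrt_nonneg _, hl2, ?_⟩
  rcases hE0.eq_or_lt with h0 | hpos
  · rw [← h0]
    have h1 : ∀ u v, A u v * ρ u v ^ 2 = 0 := by
      intro u v
      have h2 := (Finset.sum_eq_zero_iff_of_nonneg fun u _ =>
        Finset.sum_nonneg fun v _ => hterm u v).1 (hE.symm.trans h0.symm) u (Finset.mem_univ u)
      exact (Finset.sum_eq_zero_iff_of_nonneg fun v _ => hterm u v).1 h2 v (Finset.mem_univ v)
    refine (Finset.sum_eq_zero fun u _ => Finset.sum_eq_zero fun v _ => ?_).trans_le hb.le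
    rcases mul_eq_zero.1 (h1 u v) with h | h
    · simp [h]
    · simp [pow_eq_zero_iff two_ne_zero |>.1 h]
  · have hlpos : 0 < √(E / b) ^ 2 := by
      rw [Real.sq_sqrt (by positivity)]
      positivity
    have h1 : (∑ u, ∑ v, (if ρ u v ≤ √(E / b) then 0 else A u v)) * √(E / b) ^ 2 ≤ E := by
      simp only [Finset.sum_mul]
      refine Finset.sum_le_sum fun u _ => Finset.sum_le_sum fun v _ => ?_
      split_ifs with h
      · simpa using hterm u v
      · push Not at h
        have := hA.nonneg u v
        gcongr
    exact le_of_mul_le_mul_right (h1.trans_eq hl2.symm) hlpos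

/-- The Poincaré inequality for `log (1 + N)` on an expander. Most edges are of length at most a
constant times the quadratic mean `l` of all edges, so a quarter of the vertices lies in one ball
whose radius is `O(l log log n)`; here the integrality of `N` matters for small `l`. The
real-valued inequality, applied to the excess of the distance to the centre of that ball over its
radius, controls the other vertices. -/
lemma sum_logDist_sq_le (hA : IsSymmStochastic A) {C : ℝ} (hC : 0 < C) (hgap : HasGap A C)
    (hV : 0 < Fintype.card V) (N : V → V → ℕ) (hN0 : ∀ u, N u u = 0)
    (hNs : ∀ u v, N u v = N v u) (hN : ∀ u v w, N u w ≤ N u v + N v w) {r : ℕ} (hr0 : 0 < r)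
    (hr : (Fintype.card V : ℝ) ≤ (1 + 1 / (4 * C)) ^ r) :
    ∑ u, ∑ v, logDist N u v ^ 2 ≤
      (24 * C + 192 * C * (1 + Real.log r / Real.log 2) ^ 2) * Fintype.card V *
        ∑ u, ∑ v, A u v * logDist N u v ^ 2 := by
  set n : ℝ := (Fintype.card V : ℝ) with hn
  have hnpos : 0 < n := Nat.cast_pos.2 hV
  set ρ := logDist N with hρ
  set φ := 1 + Real.log r / Real.log 2 with hφ
  set E := ∑ u, ∑ v, A u v * ρ u v ^ 2 with hE
  have hφ0 : 0 ≤ φ := by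
    have : 0 ≤ Real.log r := Real.log_natCast_nonneg r
    have : 0 ≤ Real.log 2 := Real.log_nonneg (by norm_num)
    positivity
  obtain ⟨l, hl0, hlE, hbad⟩ := exists_threshold hA ρ
    (b := 1 / (2 * C) / 8 * n) (by positivity)
  -- an edge has `log (1 + N) ≤ l` if and only if its integer length is at most `q`
  set q := ⌊Real.exp l - 1⌋₊ with hq
  have hexp0 : 0 ≤ Real.exp l - 1 := by linarith [Real.add_one_le_exp l]
  have hgood : ∀ u v, ρ u v ≤ l ↔ N u v ≤ q := by
    intro u v
    rw [hq, Nat.le_floor_iff hexp0, hρ, logDist, Real.log_le_iff_le_exp (by positivity)]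
    constructor <;> intro h <;> linarith
  simp only [hgood] at hbad
  have hr' : n ≤ (1 + 1 / (2 * C) / 2) ^ r := by
    convert hr using 3
    field_simp
    norm_num
  obtain ⟨p, B, hB, hpB⟩ := exists_large_ball hA (h := 1 / (2 * C)) (by positivity)
    (fun S hS => hgap.card_le hA hC hS) hV N hN0 hN q hbad hr'
  have hql : Real.log (1 + q) ≤ l := by
    rw [Real.log_le_iff_le_exp (by positivity)]
    linarith [Nat.floor_le hexp0]
  set R := φ * l with hR
  have hpR : ∀ v ∈ B, ρ p v ≤ R := fun v hv =>
    (logDist_le_log (hpB v hv)).trans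
      ((log_one_add_mul_le hr0 q).trans (mul_le_mul_of_nonneg_left hql hφ0))
  set f : V → ℝ := fun v => max (ρ p v - R) 0 with hf
  have hfB : ∀ v ∈ B, f v = 0 := fun v hv => max_eq_right (by linarith [hpR v hv])
  have hρs : ∀ u v, ρ u v = ρ v u := logDist_comm hNs
  have hρt : ∀ u v w, ρ u w ≤ ρ u v + ρ v w := logDist_triangle hN
  have hlip : ∀ u v, (f u - f v) ^ 2 ≤ ρ u v ^ 2 := by
    intro u v
    refine sq_le_sq' ?_ ?_
    · have h1 := hρt p u v
      have h2 : f v ≤ f u + ρ u v := max_le (by linarith [le_max_left (ρ p u - R) 0])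
        (add_nonneg (le_max_right _ _) (logDist_nonneg u v))
      linarith
    · have h1 := hρt p v u
      have h2 : f u ≤ f v + ρ u v := max_le
        (by linarith [le_max_left (ρ p v - R) 0, hρs u v])
        (add_nonneg (le_max_right _ _) (logDist_nonneg u v))
      linarith
  have hfsum : ∑ v, f v ^ 2 ≤ 4 * C * E := by
    have h1 : B.card * ∑ v, f v ^ 2 ≤ ∑ u, ∑ v, (f u - f v) ^ 2 := by
      calc B.card * ∑ v, f v ^ 2 = ∑ u ∈ B, ∑ v, (f u - f v) ^ 2 := by
            rw [← nsmul_eq_mul, ← Finset.sum_const]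
            refine Finset.sum_congr rfl fun u hu => Finset.sum_congr rfl fun v _ => ?_
            rw [hfB u hu]
            ring
        _ ≤ _ := Finset.sum_le_univ_sum_of_nonneg fun u =>
            Finset.sum_nonneg fun v _ => sq_nonneg _
    have h2 : ∑ u, ∑ v, A u v * (f u - f v) ^ 2 ≤ E :=
      Finset.sum_le_sum fun u _ => Finset.sum_le_sum fun v _ =>
        mul_le_mul_of_nonneg_left (hlip u v) (hA.nonneg u v)
    have h3 : n ≤ 4 * B.card := by rw [hn]; exact_mod_cast hB
    have h4 : 0 ≤ ∑ v, f v ^ 2 := Finset.sum_nonneg fun v _ => sq_nonneg _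
    have h5 : n * ∑ v, f v ^ 2 ≤ n * (4 * C * E) := by
      calc n * ∑ v, f v ^ 2 ≤ 4 * B.card * ∑ v, f v ^ 2 := by gcongr
        _ ≤ 4 * (C * n * ∑ u, ∑ v, A u v * (f u - f v) ^ 2) := by
            linarith [hgap f]
        _ ≤ 4 * (C * n * E) := by gcongr
        _ = _ := by ring
    exact le_of_mul_le_mul_left h5 hnpos
  have hpt : ∀ u v, ρ u v ^ 2 ≤ 3 * f u ^ 2 + 3 * f v ^ 2 + 12 * R ^ 2 := by
    intro u v
    have h0 : 0 ≤ ρ u v := logDist_nonneg u v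
    have h1 := hρt u p v
    have h2 := le_max_left (ρ p u - R) 0
    have h3 := le_max_left (ρ p v - R) 0
    have h4 : ρ u v ≤ f u + f v + 2 * R := by
      have := hρs u p
      simp only [hf]
      linarith
    nlinarith [sq_nonneg (f u - f v), sq_nonneg (f u - 2 * R), sq_nonneg (f v - 2 * R)]
  have hsum : ∑ u, ∑ v, ρ u v ^ 2 ≤ 6 * n * ∑ v, f v ^ 2 + 12 * n ^ 2 * R ^ 2 := by
    calc ∑ u, ∑ v, ρ u v ^ 2 ≤ ∑ u : V, ∑ v : V, (3 * f u ^ 2 + 3 * f v ^ 2 + 12 * R ^ 2) :=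
          Finset.sum_le_sum fun u _ => Finset.sum_le_sum fun v _ => hpt u v
      _ = _ := by
          simp only [Finset.sum_add_distrib, Finset.sum_const, Finset.card_univ, nsmul_eq_mul,
            ← Finset.mul_sum, ← hn]
          ring
  have hR2 : n * R ^ 2 = 16 * C * φ ^ 2 * E := by
    rw [hE, ← hlE, hR]
    field_simp
    ring
  calc ∑ u, ∑ v, ρ u v ^ 2 ≤ 6 * n * ∑ v, f v ^ 2 + 12 * n ^ 2 * R ^ 2 := hsum
    _ ≤ 6 * n * (4 * C * E) + 12 * n * (16 * C * φ ^ 2 * E) := by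
        rw [← hR2]
        have := mul_le_mul_of_nonneg_left hfsum (by positivity : 0 ≤ 6 * n)
        nlinarith
    _ = _ := by ring

/-- On a lazy matrix `x i` and `y i` are close to each other on average, so that the inequality for
two sequences of points follows from that for one. -/
lemma poincarePlus_logDist_le (hA : IsSymmStochastic A) {C : ℝ} (hC : 0 < C) (hgap : HasGap A C)
    (hlazy : ∀ u, 1 / 2 ≤ A u u) (hV : 0 < Fintype.card V) {X : Type*} (N : X → X → ℕ)
    (hN0 : ∀ u, N u u = 0) (hNs : ∀ u v, N u v = N v u) (hN : ∀ u v w, N u w ≤ N u v + N v w)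
    {r : ℕ} (hr0 : 0 < r) (hr : (Fintype.card V : ℝ) ≤ (1 + 1 / (4 * C)) ^ r) :
    poincarePlus A (fun x y => logDist N x y ^ 2) ≤
      ENNReal.ofReal
        (12 * (24 * C + 192 * C * (1 + Real.log r / Real.log 2) ^ 2) + 4) := by
  set c := 24 * C + 192 * C * (1 + Real.log r / Real.log 2) ^ 2 with hc
  have hc0 : 0 ≤ c := by positivity
  refine poincarePlus_le_of_forall (by positivity) hV fun x y => ?_
  set n : ℝ := (Fintype.card V : ℝ) with hn
  have hnpos : 0 < n := Nat.cast_pos.2 hV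
  set E := ∑ i, ∑ j, A i j * logDist N (x i) (y j) ^ 2 with hE
  have hρs : ∀ u v, logDist N u v = logDist N v u := logDist_comm hNs
  have hρt : ∀ u v w, logDist N u w ≤ logDist N u v + logDist N v w := logDist_triangle hN
  have hsq : ∀ u v w, logDist N u w ^ 2 ≤ 2 * logDist N u v ^ 2 + 2 * logDist N v w ^ 2 := by
    intro u v w
    have h0 : 0 ≤ logDist N u w := logDist_nonneg u w
    nlinarith [hρt u v w, sq_nonneg (logDist N u v - logDist N v w)]
  have hdiag : ∑ j, logDist N (x j) (y j) ^ 2 ≤ 2 * E := by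
    rw [hE, Finset.mul_sum]
    refine Finset.sum_le_sum fun j _ => ?_
    have h1 : A j j * logDist N (x j) (y j) ^ 2 ≤ ∑ k, A j k * logDist N (x j) (y k) ^ 2 :=
      Finset.single_le_sum (f := fun k => A j k * logDist N (x j) (y k) ^ 2)
        (fun k _ => mul_nonneg (hA.nonneg j k) (sq_nonneg _)) (Finset.mem_univ j)
    nlinarith [hlazy j, sq_nonneg (logDist N (x j) (y j))]
  have hone := sum_logDist_sq_le hA hC hgap hV (fun u v => N (x u) (x v)) (fun u => hN0 _)
    (fun u v => hNs _ _) (fun u v w => hN _ _ _) hr0 hr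
  have hloc : ∑ i, ∑ j, A i j * logDist N (x i) (x j) ^ 2 ≤ 6 * E := by
    calc ∑ i, ∑ j, A i j * logDist N (x i) (x j) ^ 2 ≤
          ∑ i, ∑ j, (2 * (A i j * logDist N (x i) (y j) ^ 2) +
            A i j * (2 * logDist N (x j) (y j) ^ 2)) := by
          refine Finset.sum_le_sum fun i _ => Finset.sum_le_sum fun j _ => ?_
          have h1 := mul_le_mul_of_nonneg_left (hsq (x i) (y j) (x j)) (hA.nonneg i j)
          rw [hρs (y j) (x j)] at h1
          linarith
      _ = 2 * E + 2 * ∑ j, logDist N (x j) (y j) ^ 2 := by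
          simp only [Finset.sum_add_distrib, ← Finset.mul_sum]
          rw [Finset.sum_comm (f := fun i j => A i j * (2 * logDist N (x j) (y j) ^ 2))]
          simp only [← Finset.sum_mul, hA.sum_col, one_mul, ← Finset.mul_sum, hE]
      _ ≤ 6 * E := by linarith
  calc ∑ i, ∑ j, logDist N (x i) (y j) ^ 2 ≤
        ∑ i, ∑ j, (2 * logDist N (x i) (x j) ^ 2 + 2 * logDist N (x j) (y j) ^ 2) :=
        Finset.sum_le_sum fun i _ => Finset.sum_le_sum fun j _ => hsq _ _ _
    _ = 2 * ∑ i, ∑ j, logDist N (x i) (x j) ^ 2 +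
          2 * n * ∑ j, logDist N (x j) (y j) ^ 2 := by
        simp only [Finset.sum_add_distrib, Finset.sum_const, Finset.card_univ, nsmul_eq_mul,
          ← Finset.mul_sum, ← hn]
        ring
    _ ≤ 2 * (c * n * (6 * E)) + 2 * n * (2 * E) := by
        have h1 : ∑ i, ∑ j, logDist N (x i) (x j) ^ 2 ≤ c * n * (6 * E) :=
          (hone : _ ≤ c * n * _).trans (mul_le_mul_of_nonneg_left hloc (by positivity))
        have h2 := mul_le_mul_of_nonneg_left hdiag (by positivity : 0 ≤ 2 * n)
        linarith
    _ = _ := by ring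

end UpperBound

/-! ### Lower bound for the Poincaré constant -/

namespace RegularMultigraph

variable {V : Type*} [Fintype V]

lemma isSymmStochastic_normAdj [DecidableEq V] (G : RegularMultigraph V) :
    IsSymmStochastic G.normAdj := by
  have hd : (G.deg : ℝ) ≠ 0 := by exact_mod_cast G.deg_pos.ne'
  refine ⟨?_, (Matrix.mem_rowStochastic_iff_sum).2 ⟨fun u v => ?_, fun u => ?_⟩⟩
  · ext u v
    simp [normAdj, G.mult_symm u v]
  · simp only [normAdj, Matrix.of_apply]
    positivity
  · simp only [normAdj, Matrix.of_apply]
    rw [← Finset.sum_div, div_eq_one_iff_eq hd, ← G.sum_mult u]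
    push_cast
    rfl

/-- Every edge of `G` joins points at distance at most `S` with respect to `N`. -/
def HasRange (G : RegularMultigraph V) (N : V → V → ℕ) (S : ℕ) : Prop :=
  ∀ u v, G.mult u v ≠ 0 → N u v ≤ S

lemma HasRange.cesaro [DecidableEq V] {G : RegularMultigraph V} {N : V → V → ℕ} {S : ℕ}
    (hG : G.HasRange N S) (hN0 : ∀ u, N u u = 0) (hN : ∀ u v w, N u w ≤ N u v + N v w)
    (t : ℕ) (ht : 0 < t) : (G.cesaro t ht).HasRange N (t * S) := by
  have hwalk : ∀ s u v, G.walkCount s u v ≠ 0 → N u v ≤ s * S := by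
    intro s
    induction s with
    | zero =>
      intro u v h
      have : u = v := by
        by_contra hne
        exact h (if_neg hne)
      simp [this, hN0]
    | succ s ih =>
      intro u v h
      obtain ⟨w, -, hw⟩ := Finset.exists_ne_zero_of_sum_ne_zero h
      have h1 := hG u w (left_ne_zero_of_mul hw)
      have h2 := ih w v (right_ne_zero_of_mul hw)
      have h3 := hN u w v
      rw [add_mul]
      omega
  intro u v h
  have h' : ∑ s ∈ Finset.range t, G.deg ^ (t - 1 - s) * G.walkCount s u v ≠ 0 := h
  obtain ⟨s, hs, hs'⟩ := Finset.exists_ne_zero_of_sum_ne_zero h'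
  refine (hwalk s u v (right_ne_zero_of_mul hs')).trans ?_
  have := Finset.mem_range.1 hs
  gcongr

/-- If edges are mapped to pairs at distance at most `S`, and at least half of all pairs of vertices
to pairs at distance at least `D`, then the Poincaré constant is large. -/
lemma le_poincarePlus_logDist [DecidableEq V] {G : RegularMultigraph V} {X : Type*}
    {N : X → X → ℕ} {x : V → X} {S D : ℕ} (hV : 0 < Fintype.card V) (hS : 0 < S)
    (hG : G.HasRange (fun u v => N (x u) (x v)) S)
    (hD : ∀ v, 2 * (Finset.univ.filter fun u => N (x u) (x v) < D).card ≤ Fintype.card V) :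
    ENNReal.ofReal (1 / 2 * (Real.log (1 + D) / Real.log (1 + S)) ^ 2) ≤
      poincarePlus G.normAdj (fun x y => logDist N x y ^ 2) := by
  refine le_iInf₂ fun c hc => ?_
  rw [ENNReal.ofReal, ENNReal.coe_le_coe]
  refine Real.toNNReal_le_iff_le_coe.2 ?_
  have hA := G.isSymmStochastic_normAdj
  have hn : (0 : ℝ) < Fintype.card V := Nat.cast_pos.2 hV
  have hS1 : (1 : ℝ) ≤ S := by exact_mod_cast hS
  have hLS : 0 < Real.log (1 + S) := Real.log_pos (by linarith)
  have hLD : 0 ≤ Real.log (1 + D) := Real.log_nonneg (by simp)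
  have h := hc x x
  have hloc : ∑ i, ∑ j, G.normAdj i j * logDist N (x i) (x j) ^ 2 ≤
      Fintype.card V * Real.log (1 + S) ^ 2 := by
    calc ∑ i, ∑ j, G.normAdj i j * logDist N (x i) (x j) ^ 2 ≤
          ∑ i, ∑ j, G.normAdj i j * Real.log (1 + S) ^ 2 := by
          refine Finset.sum_le_sum fun i _ => Finset.sum_le_sum fun j _ => ?_
          by_cases hij : G.mult i j = 0
          · simp [normAdj, hij]
          · have := logDist_le_log (hG i j hij)
            have h0 : 0 ≤ logDist N (x i) (x j) := logDist_nonneg _ _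
            have := hA.nonneg i j
            gcongr
      _ = _ := by
          simp only [← Finset.sum_mul, hA.sum_row]
          simp
  have hglob : (Fintype.card V : ℝ) ^ 2 / 2 * Real.log (1 + D) ^ 2 ≤
      ∑ i, ∑ j, logDist N (x i) (x j) ^ 2 := by
    rw [Finset.sum_comm]
    have hcol : ∀ j, (Fintype.card V : ℝ) / 2 * Real.log (1 + D) ^ 2 ≤
        ∑ i, logDist N (x i) (x j) ^ 2 := by
      intro j
      set far := Finset.univ.filter fun u => ¬ N (x u) (x j) < D with hfar
      have hcard : (Fintype.card V : ℝ) / 2 ≤ far.card := by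
        have h1 := Finset.card_filter_add_card_filter_not (s := (Finset.univ : Finset V))
          (fun u => N (x u) (x j) < D)
        rw [← hfar, Finset.card_univ] at h1
        have h2 := hD j
        have h3 : Fintype.card V ≤ 2 * far.card := by omega
        have h4 : (Fintype.card V : ℝ) ≤ 2 * far.card := by exact_mod_cast h3
        linarith
      calc (Fintype.card V : ℝ) / 2 * Real.log (1 + D) ^ 2 ≤
            far.card * Real.log (1 + D) ^ 2 := by gcongr
        _ = ∑ i ∈ far, Real.log (1 + D) ^ 2 := by simp
        _ ≤ ∑ i ∈ far, logDist N (x i) (x j) ^ 2 := by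
            refine Finset.sum_le_sum fun i hi => ?_
            have h1 : D ≤ N (x i) (x j) := by simpa [hfar] using hi
            have := log_le_logDist h1
            gcongr
        _ ≤ _ := Finset.sum_le_univ_sum_of_nonneg fun i => sq_nonneg _
    calc (Fintype.card V : ℝ) ^ 2 / 2 * Real.log (1 + D) ^ 2 =
          ∑ j : V, (Fintype.card V : ℝ) / 2 * Real.log (1 + D) ^ 2 := by
          simp only [Finset.sum_const, Finset.card_univ, nsmul_eq_mul]
          ring
      _ ≤ _ := Finset.sum_le_sum fun j _ => hcol j
  have h1 : 1 / (Fintype.card V : ℝ) ^ 2 * ((Fintype.card V : ℝ) ^ 2 / 2 * Real.log (1 + D) ^ 2) ≤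
      c / (Fintype.card V : ℝ) * (Fintype.card V * Real.log (1 + S) ^ 2) :=
    (mul_le_mul_of_nonneg_left hglob (by positivity)).trans
      (h.trans (mul_le_mul_of_nonneg_left hloc (by positivity)))
  have h2 : 1 / 2 * Real.log (1 + D) ^ 2 ≤ c * Real.log (1 + S) ^ 2 := by
    convert h1 using 1 <;> field_simp
  rw [div_pow, ← mul_div_assoc, div_le_iff₀ (by positivity)]
  exact h2

variable [DecidableEq V]

/-- The vertices that are joined to `w` by a walk of length `r`. In a graph with a self-loop at
each vertex this is the ball of radius `r` about `w`. -/
def walkBall (G : RegularMultigraph V) : ℕ → V → Finset V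
  | 0, w => {w}
  | r + 1, w => (walkBall G r w).biUnion fun v => Finset.univ.filter fun u => G.mult v u ≠ 0

lemma card_walkBall_le (G : RegularMultigraph V) {b : ℕ}
    (hb : ∀ v, (Finset.univ.filter fun u => G.mult v u ≠ 0).card ≤ b) (r : ℕ) (w : V) :
    (G.walkBall r w).card ≤ b ^ r := by
  induction r with
  | zero => simp [walkBall]
  | succ r ih =>
    rw [pow_succ]
    exact (Finset.card_biUnion_le_card_mul _ _ b fun v _ => hb v).trans
      (Nat.mul_le_mul_right b ih)

lemma monotone_walkBall (G : RegularMultigraph V) (hloop : ∀ v, G.mult v v ≠ 0) (w : V) :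
    Monotone fun r => G.walkBall r w :=
  monotone_nat_of_le_succ fun r v hv =>
    Finset.mem_biUnion.2 ⟨v, hv, by simpa using hloop v⟩

/-- The distance in `G` from `u` to `w`, truncated at `M`. -/
def truncDist (G : RegularMultigraph V) (M : ℕ) (u w : V) : ℕ :=
  ((Finset.range M).filter fun r => u ∉ G.walkBall r w).card

lemma truncDist_self (G : RegularMultigraph V) (hloop : ∀ v, G.mult v v ≠ 0) (M : ℕ) (w : V) :
    G.truncDist M w w = 0 := by
  rw [truncDist, Finset.card_eq_zero, Finset.filter_eq_empty_iff]
  intro r _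
  rw [not_not]
  exact G.monotone_walkBall hloop w (Nat.zero_le r) (by simp [walkBall])

lemma truncDist_le_add_one (G : RegularMultigraph V) (M : ℕ) {u v : V} (huv : G.mult u v ≠ 0)
    (w : V) : G.truncDist M v w ≤ G.truncDist M u w + 1 := by
  have hsub : ((Finset.range M).filter fun r => v ∉ G.walkBall r w) ⊆
      insert 0 (((Finset.range M).filter fun r => u ∉ G.walkBall r w).image Nat.succ) := by
    intro r hr
    rw [Finset.mem_filter, Finset.mem_range] at hr
    rcases r with _ | r
    · simp
    · refine Finset.mem_insert_of_mem (Finset.mem_image_of_mem _ ?_)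
      rw [Finset.mem_filter, Finset.mem_range]
      exact ⟨by omega, fun hu => hr.2 (Finset.mem_biUnion.2 ⟨u, hu, by simpa using huv⟩)⟩
  calc G.truncDist M v w ≤ _ := Finset.card_le_card hsub
    _ ≤ _ := Finset.card_insert_le _ _
    _ ≤ G.truncDist M u w + 1 := Nat.add_le_add_right Finset.card_image_le 1

lemma mem_walkBall_of_truncDist_lt (G : RegularMultigraph V) (hloop : ∀ v, G.mult v v ≠ 0) {M : ℕ}
    {u w : V} (h : G.truncDist M u w < M) : u ∈ G.walkBall M w := by
  by_contra hu
  have : ((Finset.range M).filter fun r => u ∉ G.walkBall r w) = Finset.range M :=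
    Finset.filter_true_of_mem fun r hr hur =>
      hu (G.monotone_walkBall hloop w (Finset.mem_range.1 hr).le hur)
  rw [truncDist, this, Finset.card_range] at h
  exact lt_irrefl _ h

/-- The Fréchet embedding of the truncated graph distance into `ℓ_∞`. -/
lemma exists_embedding {n : ℕ} (G : RegularMultigraph (Fin n)) (hloop : ∀ v, G.mult v v ≠ 0)
    {b : ℕ} (hb : ∀ v, (Finset.univ.filter fun u => G.mult v u ≠ 0).card ≤ b) (M : ℕ) :
    ∃ x : Fin n → ℕ →₀ ℤ, G.HasRange (fun u v => natDist (x u) (x v)) 1 ∧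
      ∀ w, (Finset.univ.filter fun u => natDist (x u) (x w) < M).card ≤ b ^ M := by
  set x : Fin n → ℕ →₀ ℤ := fun u => Finsupp.onFinset (Finset.range n)
    (fun i => if h : i < n then (G.truncDist M u ⟨i, h⟩ : ℤ) else 0) (fun i hi => by
      by_contra h
      rw [Finset.mem_range] at h
      exact hi (dif_neg h)) with hx
  refine ⟨x, fun u v huv => natDist_le_iff.2 fun i => ?_, fun w => ?_⟩
  · by_cases hi : i < n
    · have h1 := G.truncDist_le_add_one M huv ⟨i, hi⟩
      have h2 := G.truncDist_le_add_one M (by rwa [G.mult_symm]) (u := v) (v := u) ⟨i, hi⟩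
      simp only [hx, Finsupp.onFinset_apply, dif_pos hi]
      omega
    · simp [hx, hi]
  · refine (Finset.card_le_card fun u hu => ?_).trans (G.card_walkBall_le hb M w)
    rw [Finset.mem_filter] at hu
    refine G.mem_walkBall_of_truncDist_lt hloop (lt_of_le_of_lt ?_ hu.2)
    have h1 := natAbs_sub_le_natDist (x u) (x w) w
    simpa [hx, G.truncDist_self hloop] using h1

end RegularMultigraph

/-! ### Expanders on every number of vertices -/

section Cayley

variable {V : Type*} [AddCommGroup V] [Fintype V]

/-- Choosing `d` elements of a finite abelian group independently and uniformly at random, the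
exponential moment of the real part of the sum of a nontrivial character over them is at most
`(17 / 16) ^ d`; a union bound over the characters gives generators without large character
sums. -/
lemma exists_small_character_sums {d : ℕ}
    (hcard : Real.log (Fintype.card V) ≤ d / 16) :
    ∃ s : Fin d → V, ∀ χ : AddChar V ℂ, χ ≠ 0 → ∑ i, (χ (s i)).re ≤ d / 2 := by
  have hn : (0 : ℝ) < Fintype.card V := Nat.cast_pos.2 Fintype.card_pos
  have hre : ∀ (χ : AddChar V ℂ) (a : V), |(χ a).re| ≤ 1 := fun χ a =>
    (Complex.abs_re_le_norm _).trans (AddChar.norm_apply χ a).le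
  have hmom : ∀ χ : AddChar V ℂ, χ ≠ 0 →
      ∑ a, Real.exp (1 / 4 * (χ a).re) ≤ Fintype.card V * (17 / 16) := by
    intro χ hχ
    have hzero : ∑ a, (χ a).re = 0 := by
      rw [← Complex.re_sum, AddChar.sum_eq_zero_iff_ne_zero.2 hχ, Complex.zero_re]
    calc ∑ a, Real.exp (1 / 4 * (χ a).re) ≤ ∑ a, (17 / 16 + 1 / 4 * (χ a).re) := by
          refine Finset.sum_le_sum fun a _ => ?_
          have h1 := abs_le.1 (hre χ a)
          have h2 : |1 / 4 * (χ a).re| ≤ 1 := by rw [abs_le]; constructor <;> linarith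
          have h3 := (abs_le.1 (Real.abs_exp_sub_one_sub_id_le h2)).2
          nlinarith
      _ = _ := by
          rw [Finset.sum_add_distrib, ← Finset.mul_sum, hzero]
          simp
  have htotal : ∑ s : Fin d → V, ∑ χ ∈ Finset.univ.erase (0 : AddChar V ℂ),
      Real.exp (1 / 4 * ∑ i, (χ (s i)).re) ≤
        ∑ s : Fin d → V, Fintype.card V * (17 / 16 : ℝ) ^ d := by
    rw [Finset.sum_comm]
    have h1 : ∀ χ ∈ Finset.univ.erase (0 : AddChar V ℂ),
        ∑ s : Fin d → V, Real.exp (1 / 4 * ∑ i, (χ (s i)).re) ≤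
          (Fintype.card V * (17 / 16)) ^ d := by
      intro χ hχ
      simp_rw [Finset.mul_sum, Real.exp_sum]
      rw [← Fintype.sum_pow fun a => Real.exp (1 / 4 * (χ a).re)]
      exact pow_le_pow_left₀ (Finset.sum_nonneg fun a _ => (Real.exp_pos _).le)
        (hmom χ (Finset.ne_of_mem_erase hχ)) d
    refine (Finset.sum_le_sum h1).trans ?_
    have h2 : ((Finset.univ.erase (0 : AddChar V ℂ)).card : ℝ) ≤ Fintype.card V := by
      rw [← AddChar.card_eq (α := V)]
      exact_mod_cast Finset.card_le_univ _
    simp only [Finset.sum_const, nsmul_eq_mul, Finset.card_univ, Fintype.card_fun,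
      Fintype.card_fin]
    push_cast
    rw [mul_pow]
    calc _ ≤ (Fintype.card V : ℝ) * ((Fintype.card V : ℝ) ^ d * (17 / 16) ^ d) := by gcongr
      _ = _ := by ring
  obtain ⟨s, -, hs⟩ := Finset.exists_le_of_sum_le
    (Finset.univ_nonempty (α := Fin d → V)) htotal
  refine ⟨s, fun χ hχ => ?_⟩
  have h1 : Real.exp (1 / 4 * ∑ i, (χ (s i)).re) ≤ Fintype.card V * (17 / 16 : ℝ) ^ d :=
    (Finset.single_le_sum (f := fun χ : AddChar V ℂ => Real.exp (1 / 4 * ∑ i, (χ (s i)).re))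
      (fun _ _ => (Real.exp_pos _).le)
      (Finset.mem_erase.2 ⟨hχ, Finset.mem_univ χ⟩)).trans hs
  have h2 : (17 / 16 : ℝ) ^ d ≤ Real.exp (d / 16) := by
    have h3 : (17 / 16 : ℝ) ≤ Real.exp (1 / 16) := by
      linarith [Real.add_one_le_exp (1 / 16 : ℝ)]
    calc (17 / 16 : ℝ) ^ d ≤ Real.exp (1 / 16) ^ d := by gcongr
      _ = Real.exp (d / 16) := by rw [← Real.exp_nat_mul]; congr 1; ring
  have h3 : (Fintype.card V : ℝ) ≤ Real.exp (d / 16) := (Real.log_le_iff_le_exp hn).1 hcard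
  have h4 : Real.exp (1 / 4 * ∑ i, (χ (s i)).re) ≤ Real.exp (d / 16 + d / 16) := by
    rw [Real.exp_add]
    exact h1.trans (mul_le_mul h3 h2 (by positivity) (by positivity))
  have h5 := Real.exp_le_exp.1 h4
  linarith

variable [DecidableEq V]

/-- The lazy Cayley graph of an abelian group: besides the edges from `u` to `u + s i` and to
`u - s i`, for each of the `d` generators `s i`, each vertex carries `2 * d` self-loops. -/
def lazyCayley {d : ℕ} (hd : 0 < d) (s : Fin d → V) : RegularMultigraph V where
  mult u v := (if u = v then 2 * d else 0) +
    ((∑ i, if u + s i = v then 1 else 0) + ∑ i, if v + s i = u then 1 else 0)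
  mult_symm u v := by
    rw [add_comm (∑ i, if v + s i = u then 1 else 0)]
    simp only [eq_comm]
  deg := 4 * d
  deg_pos := by omega
  sum_mult u := by
    have h : ∀ i v, (if v + s i = u then 1 else 0) = if u - s i = v then 1 else 0 := fun i v => by
      have hiff : v + s i = u ↔ u - s i = v := by rw [sub_eq_iff_eq_add, eq_comm]
      simp only [hiff]
    simp only [Finset.sum_add_distrib, h]
    rw [Finset.sum_comm, Finset.sum_comm (f := fun v i => if u - s i = v then 1 else 0)]
    simp
    omega

lemma lazyCayley_mult_self {d : ℕ} (hd : 0 < d) (s : Fin d → V) (v : V) :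
    2 * d ≤ (lazyCayley hd s).mult v v := by simp [lazyCayley]

lemma card_neighbors_lazyCayley {d : ℕ} (hd : 0 < d) (s : Fin d → V) (v : V) :
    (Finset.univ.filter fun u => (lazyCayley hd s).mult v u ≠ 0).card ≤ 2 * d + 1 := by
  have hsub : (Finset.univ.filter fun u => (lazyCayley hd s).mult v u ≠ 0) ⊆
      {v} ∪ (Finset.univ.image (fun i => v + s i) ∪ Finset.univ.image fun i => v - s i) := by
    intro u hu
    by_contra hnot
    simp only [Finset.mem_union, Finset.mem_singleton, Finset.mem_image, Finset.mem_univ, true_and,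
      not_or, not_exists] at hnot
    obtain ⟨h1, h2, h3⟩ := hnot
    simp only [Finset.mem_filter, Finset.mem_univ, true_and] at hu
    apply hu
    have h4 : ∀ i, u + s i ≠ v := fun i hi => h3 i (by rw [← hi]; abel)
    simp [lazyCayley, Ne.symm h1, h2, h4]
  refine (Finset.card_le_card hsub).trans ((Finset.card_union_le _ _).trans ?_)
  have h1 := Finset.card_union_le (Finset.univ.image fun i => v + s i)
    (Finset.univ.image fun i => v - s i)
  have h2 : (Finset.univ.image fun i => v + s i).card ≤ d := by
    simpa using Finset.card_image_le (s := Finset.univ) (f := fun i => v + s i)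
  have h3 : (Finset.univ.image fun i => v - s i).card ≤ d := by
    simpa using Finset.card_image_le (s := Finset.univ) (f := fun i => v - s i)
  rw [Finset.card_singleton]
  omega

/-- Parseval's identity, for real-valued functions on a finite abelian group. -/
lemma sum_normSq_fourier (f : V → ℝ) :
    ∑ χ : AddChar V ℂ, Complex.normSq (∑ x, f x * χ x) = Fintype.card V * ∑ x, f x ^ 2 := by
  have h : ((∑ χ : AddChar V ℂ, Complex.normSq (∑ x, f x * χ x) : ℝ) : ℂ) =
      ((Fintype.card V * ∑ x, f x ^ 2 : ℝ) : ℂ) := by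
    push_cast
    have h1 : ∀ χ : AddChar V ℂ, ((Complex.normSq (∑ x, f x * χ x) : ℝ) : ℂ) =
        ∑ x, ∑ y, (f x : ℂ) * f y * χ (x - y) := by
      intro χ
      rw [← Complex.mul_conj, map_sum, Finset.sum_mul_sum]
      refine Finset.sum_congr rfl fun x _ => Finset.sum_congr rfl fun y _ => ?_
      rw [map_mul, Complex.conj_ofReal, sub_eq_add_neg, AddChar.map_add_eq_mul,
        AddChar.map_neg_eq_conj]
      ring
    simp_rw [h1]
    rw [Finset.sum_comm, Finset.mul_sum]
    refine Finset.sum_congr rfl fun x _ => ?_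
    rw [Finset.sum_comm]
    simp_rw [← Finset.mul_sum, AddChar.sum_apply_eq_ite, sub_eq_zero]
    simp
    ring
  exact_mod_cast h

/-- The Fourier transform of `f (x + a) - f x` at `χ` is that of `f` times `χ (-a) - 1`. -/
lemma sum_shift_sub_sq (f : V → ℝ) (a : V) :
    Fintype.card V * ∑ x, (f (x + a) - f x) ^ 2 =
      ∑ χ : AddChar V ℂ, (2 - 2 * (χ a).re) * Complex.normSq (∑ x, f x * χ x) := by
  rw [← sum_normSq_fourier fun x => f (x + a) - f x]
  refine Finset.sum_congr rfl fun χ _ => ?_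
  have h1 : ∑ x, ((f (x + a) - f x : ℝ) : ℂ) * χ x = (χ (-a) - 1) * ∑ x, f x * χ x := by
    have h2 : ∑ x, (f (x + a) : ℂ) * χ x = ∑ x, f x * χ (x - a) := by
      refine Fintype.sum_equiv (Equiv.addRight a) _ _ fun x => ?_
      simp
    push_cast
    simp_rw [sub_mul, Finset.sum_sub_distrib, h2, sub_eq_add_neg, AddChar.map_add_eq_mul,
      Finset.mul_sum]
    simp only [one_mul]
    congr 1
    exact Finset.sum_congr rfl fun x _ => by ring
  rw [h1, map_mul]
  congr 1
  have h3 : Complex.normSq (χ a) = 1 := by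
    rw [Complex.normSq_eq_norm_sq, AddChar.norm_apply, one_pow]
  rw [Complex.normSq_apply] at h3
  rw [AddChar.map_neg_eq_conj, Complex.normSq_apply]
  simp only [Complex.sub_re, Complex.conj_re, Complex.one_re, Complex.sub_im, Complex.conj_im,
    Complex.one_im]
  linarith

/-- The eigenvalues of the graph belong to the characters, and those of nontrivial characters are at
most `1 / 2 + 1 / 2 * (1 / 2) = 1 - 1 / 4`. -/
lemma hasGap_lazyCayley {d : ℕ} (hd : 0 < d) (s : Fin d → V)
    (hs : ∀ χ : AddChar V ℂ, χ ≠ 0 → ∑ i, (χ (s i)).re ≤ d / 2) :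
    HasGap (lazyCayley hd s).normAdj 4 := by
  intro f
  have hd' : (0 : ℝ) < d := Nat.cast_pos.2 hd
  set n : ℝ := (Fintype.card V : ℝ) with hn
  set Q := ∑ i, ∑ x, (f (x + s i) - f x) ^ 2 with hQ
  have hloc : ∑ u, ∑ v, (lazyCayley hd s).normAdj u v * (f u - f v) ^ 2 = Q / (2 * d) := by
    have h1 : ∑ u, ∑ v, ∑ i, (if u + s i = v then (1 : ℝ) else 0) * (f u - f v) ^ 2 = Q := by
      have h2 : ∀ u, ∑ v, ∑ i, (if u + s i = v then (1 : ℝ) else 0) * (f u - f v) ^ 2 =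
          ∑ i, (f (u + s i) - f u) ^ 2 := fun u => by
        rw [Finset.sum_comm]
        refine Finset.sum_congr rfl fun i _ => ?_
        simp only [ite_mul, one_mul, zero_mul, Finset.sum_ite_eq, Finset.mem_univ, if_true]
        ring
      simp_rw [h2]
      exact Finset.sum_comm
    have h3 : ∀ u v, (lazyCayley hd s).normAdj u v * (f u - f v) ^ 2 =
        (∑ i, (if u + s i = v then (1 : ℝ) else 0) * (f u - f v) ^ 2) / (4 * d) +
          (∑ i, (if v + s i = u then (1 : ℝ) else 0) * (f v - f u) ^ 2) / (4 * d) := by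
      intro u v
      simp only [RegularMultigraph.normAdj, lazyCayley, Matrix.of_apply, ← Finset.sum_mul]
      push_cast
      by_cases huv : u = v
      · simp [huv]
      · simp only [huv, if_false]
        ring
    simp_rw [h3, Finset.sum_add_distrib, ← Finset.sum_div]
    rw [Finset.sum_comm (f := fun u v =>
      ∑ i, (if v + s i = u then (1 : ℝ) else 0) * (f v - f u) ^ 2), h1]
    field_simp
    ring
  have hF0 : ∑ x, (f x : ℂ) * (0 : AddChar V ℂ) x = ((∑ x, f x : ℝ) : ℂ) := by simp
  have hglob : ∑ u, ∑ v, (f u - f v) ^ 2 = 2 * (n * ∑ x, f x ^ 2 - (∑ x, f x) ^ 2) := by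
    have h1 : ∀ u v, (f u - f v) ^ 2 = f u ^ 2 + f v ^ 2 - 2 * (f u * f v) := fun u v => by ring
    simp_rw [h1, Finset.sum_sub_distrib, Finset.sum_add_distrib, ← Finset.mul_sum,
      ← Finset.sum_mul]
    simp only [Finset.sum_const, Finset.card_univ, nsmul_eq_mul, ← hn, ← Finset.mul_sum]
    ring
  have hspec : d * (n * ∑ x, f x ^ 2 - (∑ x, f x) ^ 2) ≤ n * Q := by
    rw [hn, ← sum_normSq_fourier f, hQ, Finset.mul_sum]
    simp_rw [sum_shift_sub_sq]
    rw [Finset.sum_comm]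
    simp_rw [← Finset.sum_mul, Finset.sum_sub_distrib, ← Finset.mul_sum]
    rw [← Finset.add_sum_erase _ _ (Finset.mem_univ (0 : AddChar V ℂ)),
      ← Finset.add_sum_erase _ _ (Finset.mem_univ (0 : AddChar V ℂ)), hF0, Complex.normSq_ofReal,
      ← sq, add_sub_cancel_left, Finset.mul_sum]
    have h0 : ∀ i, ((0 : AddChar V ℂ) (s i)).re = 1 := fun i => by simp
    simp only [h0, Finset.sum_const, Finset.card_univ, Fintype.card_fin, nsmul_eq_mul]
    have h1 : ∀ χ ∈ Finset.univ.erase (0 : AddChar V ℂ),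
        d * Complex.normSq (∑ x, f x * χ x) ≤
          (d * 2 - 2 * ∑ i, (χ (s i)).re) * Complex.normSq (∑ x, f x * χ x) := by
      intro χ hχ
      have := hs χ (Finset.ne_of_mem_erase hχ)
      refine mul_le_mul_of_nonneg_right ?_ (Complex.normSq_nonneg _)
      linarith
    have := Finset.sum_le_sum h1
    linarith
  rw [hloc, hglob]
  have h4 : 4 * n * (Q / (2 * d)) = 2 * (n * Q / d) := by
    field_simp
    ring
  rw [h4]
  have h5 : n * ∑ x, f x ^ 2 - (∑ x, f x) ^ 2 ≤ n * Q / d := by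
    rw [le_div_iff₀ hd']
    linarith
  linarith

end Cayley

/-- For each `n` there is an expander of logarithmic degree; its Poincaré constant with respect to
`log (1 + N)` is at most of the order of `(log log n) ^ 2`. -/
lemma exists_expander {X : Type*} (N : X → X → ℕ) (hN0 : ∀ u, N u u = 0)
    (hNs : ∀ u v, N u v = N v u) (hN : ∀ u v w, N u w ≤ N u v + N v w) {n m : ℕ} (hn : 0 < n)
    (hm : n ≤ 2 ^ m) (hm0 : 0 < m) :
    ∃ G : RegularMultigraph (Fin n), (∀ v, G.mult v v ≠ 0) ∧
      (∀ v, (Finset.univ.filter fun u => G.mult v u ≠ 0).card ≤ 32 * m + 1) ∧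
      poincarePlus G.normAdj (fun x y => logDist N x y ^ 2) ≤
        ENNReal.ofReal (10372 * (1 + Real.log (12 * m : ℕ) / Real.log 2) ^ 2) := by
  have : NeZero n := ⟨hn.ne'⟩
  have hnm : (n : ℝ) ≤ 2 ^ m := by exact_mod_cast hm
  have hd : 0 < 16 * m := by omega
  -- `16 * m` generators suffice, as `log n ≤ m`
  obtain ⟨s, hs⟩ := exists_small_character_sums (V := Fin n) (d := 16 * m) (by
    rw [Fintype.card_fin]
    have h1 : Real.log n ≤ Real.log (2 ^ m) :=
      Real.log_le_log (by exact_mod_cast hn) hnm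
    rw [Real.log_pow] at h1
    have h2 : Real.log 2 ≤ 1 := by linarith [Real.log_two_lt_d9]
    have h3 : (m : ℝ) * Real.log 2 ≤ m * 1 := by gcongr
    push_cast
    linarith)
  set G := lazyCayley hd s with hG
  have hloop := lazyCayley_mult_self hd s
  refine ⟨G, fun v => by have := hloop v; rw [← hG] at this; omega,
    fun v => (card_neighbors_lazyCayley hd s v).trans (by omega), ?_⟩
  have hlazy : ∀ u, 1 / 2 ≤ G.normAdj u u := by
    intro u
    have h1 : ((2 * (16 * m) : ℕ) : ℝ) ≤ G.mult u u := Nat.cast_le.2 (hloop u)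
    have h2 : (G.deg : ℝ) = 4 * (16 * m : ℕ) := by simp [hG, lazyCayley]
    have h3 : (0 : ℝ) < (16 * m : ℕ) := Nat.cast_pos.2 hd
    simp only [RegularMultigraph.normAdj, Matrix.of_apply]
    rw [h2, le_div_iff₀ (by positivity)]
    push_cast at h1 ⊢
    linarith
  refine (poincarePlus_logDist_le G.isSymmStochastic_normAdj (C := 4) (by norm_num)
    (hasGap_lazyCayley hd s hs) hlazy (by simpa using hn) N hN0 hNs hN (r := 12 * m) (by omega)
    ?_).trans (ENNReal.ofReal_le_ofReal ?_)
  · rw [Fintype.card_fin, pow_mul]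
    -- `2 ≤ (17 / 16) ^ 12`
    exact hnm.trans (pow_le_pow_left₀ (by norm_num) (by norm_num) m)
  · have h1 : 0 ≤ Real.log (12 * m : ℕ) := Real.log_natCast_nonneg _
    have h2 : 0 ≤ Real.log 2 := Real.log_nonneg (by norm_num)
    have h3 : 0 ≤ Real.log (12 * m : ℕ) / Real.log 2 := by positivity
    nlinarith

/-! ### Iterated Cesàro averaging -/

/-- If averaging over some `t ≤ T` steps reduces the Poincaré constant by more than a factor `2`,
pass to the averaged graph, and repeat this at most `k` times. Meanwhile the range of the graph
grows at most `T ^ k`-fold. -/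
lemma exists_stable_or_small {V X : Type*} [Fintype V] [DecidableEq V] (H : RegularMultigraph V)
    (K : X → X → ℝ) (N : V → V → ℕ) (hN0 : ∀ u, N u u = 0)
    (hN : ∀ u v w, N u w ≤ N u v + N v w) (hH : H.HasRange N 1) {T : ℕ} (hT : 0 < T) (k : ℕ) :
    ∃ G : RegularMultigraph V, G.HasRange N (T ^ k) ∧
      poincarePlus G.normAdj K ≤ poincarePlus H.normAdj K ∧
      ((∀ (t : ℕ) (ht : 0 < t), t ≤ T →
          (1 / 2 : ℝ≥0∞) * poincarePlus G.normAdj K ≤ poincarePlus (G.cesaro t ht).normAdj K) ∨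
        2 ^ k * poincarePlus G.normAdj K ≤ poincarePlus H.normAdj K) := by
  induction k with
  | zero => exact ⟨H, by simpa using hH, le_rfl, Or.inr (by simp)⟩
  | succ k ih =>
    obtain ⟨G, hG, hGH, hcase⟩ := ih
    have hG' : G.HasRange N (T ^ (k + 1)) := fun u v huv =>
      (hG u v huv).trans (Nat.pow_le_pow_right hT (Nat.le_succ k))
    by_cases hstable : ∀ (t : ℕ) (ht : 0 < t), t ≤ T →
        (1 / 2 : ℝ≥0∞) * poincarePlus G.normAdj K ≤ poincarePlus (G.cesaro t ht).normAdj K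
    · exact ⟨G, hG', hGH, Or.inl hstable⟩
    have hsmall := hcase.resolve_left hstable
    push Not at hstable
    obtain ⟨t, ht, htT, hlt⟩ := hstable
    have h2 : 2 * poincarePlus (G.cesaro t ht).normAdj K ≤ poincarePlus G.normAdj K := by
      calc 2 * poincarePlus (G.cesaro t ht).normAdj K ≤
            2 * ((1 / 2 : ℝ≥0∞) * poincarePlus G.normAdj K) := by gcongr
        _ = poincarePlus G.normAdj K := by
            rw [← mul_assoc, one_div, ENNReal.mul_inv_cancel two_ne_zero ENNReal.ofNat_ne_top,
              one_mul]
    refine ⟨G.cesaro t ht, fun u v huv => (hG.cesaro hN0 hN t ht u v huv).trans ?_, ?_, Or.inr ?_⟩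
    · rw [pow_succ']
      gcongr
    · refine le_trans ?_ (h2.trans hGH)
      rw [two_mul]
      exact le_self_add
    · rw [pow_succ, mul_assoc]
      exact (mul_le_mul_right h2 _).trans hsmall

/-- The numerical conditions under which the iteration stops in time; here `j` is of the order
of `log log n`. -/
lemma eventually_parameters (a : ℕ) : ∃ j₀ : ℕ, ∀ j : ℕ, j₀ ≤ j →
    (j + 7) * 2 ^ (j / 2) + 2 ≤ 2 ^ j ∧
      2 * a * (a * (16 + 2 * Nat.log 2 (j + 6)) + 1) ≤ j / 2 := by
  have hlin : ∀ i : ℕ, 6 ≤ i → 2 * i + 10 ≤ 2 ^ i := by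
    intro i hi
    induction i, hi using Nat.le_induction with
    | base => norm_num
    | succ i hi ih =>
      rw [pow_succ]
      omega
  have hquad : ∀ c y : ℕ, 4 * c ≤ y → c * (y + 1) ≤ 2 ^ y := by
    intro c y hy
    have h1 : y / 2 + 1 ≤ 2 ^ (y / 2) := Nat.lt_two_pow_self
    calc c * (y + 1) ≤ (y / 2 + 1) * (y / 2 + 1) := by
          have h2 : y + 1 ≤ 2 * (y / 2 + 1) := by omega
          have h3 : 2 * c ≤ y / 2 + 1 := by omega
          nlinarith
      _ ≤ 2 ^ (y / 2) * 2 ^ (y / 2) := Nat.mul_le_mul h1 h1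
      _ = 2 ^ (y / 2 + y / 2) := (pow_add _ _ _).symm
      _ ≤ 2 ^ y := Nat.pow_le_pow_right (by norm_num) (by omega)
  set c := 64 * a ^ 2 + 4 * a + 8 with hc
  refine ⟨2 ^ (4 * c) + 12, fun j hj => ⟨?_, ?_⟩⟩
  · have h1 := hlin (j / 2) (by have := Nat.zero_le (2 ^ (4 * c)); omega)
    calc (j + 7) * 2 ^ (j / 2) + 2 ≤ (2 * (j / 2) + 10) * 2 ^ (j / 2) := by
          have h2 : 1 ≤ 2 ^ (j / 2) := Nat.one_le_two_pow
          have h3 : j ≤ 2 * (j / 2) + 1 := by omega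
          nlinarith
      _ ≤ 2 ^ (j / 2) * 2 ^ (j / 2) := Nat.mul_le_mul_right _ h1
      _ = 2 ^ (j / 2 + j / 2) := (pow_add _ _ _).symm
      _ ≤ 2 ^ j := Nat.pow_le_pow_right (by norm_num) (by omega)
  · set y := Nat.log 2 (j + 6) with hy
    have h1 : 2 ^ y ≤ j + 6 := Nat.pow_log_le_self 2 (by omega)
    have h2 : 4 * c ≤ y := by
      calc 4 * c = Nat.log 2 (2 ^ (4 * c)) := (Nat.log_pow (by norm_num) _).symm
        _ ≤ y := Nat.log_mono_right (by omega)
    have h3 := hquad c y h2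
    have h4 : 2 * (2 * a * (a * (16 + 2 * y) + 1)) + 8 ≤ c * (y + 1) := by
      rw [hc]
      nlinarith [Nat.zero_le (a ^ 2 * y), Nat.zero_le (a * y)]
    omega

/-- With `m` and `j` of the order of `log n` and `log log n`, the bound of `exists_expander` is less
than two to the power of a multiple of `log log log n`. -/
lemma expander_bound_le {m j l : ℕ} (hm : 12 * m ≤ 2 ^ (j + 5)) (hl : j + 6 ≤ 2 ^ (l + 1)) :
    10372 * (1 + Real.log (12 * m : ℕ) / Real.log 2) ^ 2 ≤ 2 ^ (16 + 2 * l) := by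
  have hl2 : 0 < Real.log 2 := Real.log_pos (by norm_num)
  have h1 : Real.log (12 * m : ℕ) / Real.log 2 ≤ j + 5 := by
    rw [div_le_iff₀ hl2]
    rcases Nat.eq_zero_or_pos m with rfl | hm0
    · simp
      positivity
    calc Real.log (12 * m : ℕ) ≤ Real.log ((2 : ℝ) ^ (j + 5)) :=
          Real.log_le_log (Nat.cast_pos.2 (by omega)) (by exact_mod_cast hm)
      _ = (j + 5) * Real.log 2 := by
          rw [Real.log_pow]
          push_cast
          ring
  have h0 : 0 ≤ Real.log (12 * m : ℕ) / Real.log 2 :=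
    div_nonneg (Real.log_natCast_nonneg _) hl2.le
  have h3 : (j : ℝ) + 6 ≤ 2 ^ (l + 1) := by exact_mod_cast hl
  calc 10372 * (1 + Real.log (12 * m : ℕ) / Real.log 2) ^ 2 ≤
        2 ^ 14 * (2 ^ (l + 1)) ^ 2 := by
        gcongr
        · norm_num
        · linarith
    _ = 2 ^ (16 + 2 * l) := by
        rw [← pow_mul, ← pow_add]
        congr 1
        ring

/-- The ratio of the logarithms of the typical distance `2 ^ i` and of the edge length `(2 ^ a) ^ k`
reached by `k` averages over at most `2 ^ a` steps. -/
lemma le_log_div_log {a k i : ℕ} (h : 2 * a * (a * k + 1) ≤ i) :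
    (2 * a : ℝ) ≤ Real.log (1 + (2 ^ i : ℕ)) / Real.log (1 + ((2 ^ a) ^ k : ℕ)) := by
  have hl2 : 0 < Real.log 2 := Real.log_pos (by norm_num)
  have hLD : i * Real.log 2 ≤ Real.log (1 + (2 ^ i : ℕ)) := by
    rw [← Real.log_pow]
    refine Real.log_le_log (by positivity) ?_
    push_cast
    linarith
  have hLS : Real.log (1 + ((2 ^ a) ^ k : ℕ)) ≤ (a * k + 1 : ℕ) * Real.log 2 := by
    rw [← Real.log_pow]
    refine Real.log_le_log (by positivity) ?_
    rw [← pow_mul, pow_succ]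
    push_cast
    have : (1 : ℝ) ≤ 2 ^ (a * k) := one_le_pow₀ (by norm_num)
    linarith
  have hLS0 : 0 < Real.log (1 + ((2 ^ a) ^ k : ℕ)) := by
    refine Real.log_pos ?_
    have : (0 : ℝ) < ((2 ^ a) ^ k : ℕ) := by positivity
    linarith
  have hpar : (2 * a : ℝ) * (a * k + 1 : ℕ) ≤ i := by exact_mod_cast h
  rw [le_div_iff₀ hLS0]
  calc (2 * a : ℝ) * Real.log (1 + ((2 ^ a) ^ k : ℕ)) ≤
        2 * a * ((a * k + 1 : ℕ) * Real.log 2) := by gcongr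
    _ = (2 * a) * (a * k + 1 : ℕ) * Real.log 2 := by ring
    _ ≤ i * Real.log 2 := by gcongr
    _ ≤ _ := hLD

/-- For large `n` some graph on `n` vertices has a finite Poincaré constant that is at least `a` and
is at most halved by averaging over at most `a` steps. -/
lemma eventually_exists_stable (a : ℕ) (ha : 0 < a) : ∀ᶠ n : ℕ in Filter.atTop,
    ∃ G : RegularMultigraph (Fin n),
      poincarePlus G.normAdj (fun x y => logDist natDist x y ^ 2) < ∞ ∧
      (a : ℝ≥0∞) ≤ poincarePlus G.normAdj (fun x y => logDist natDist x y ^ 2) ∧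
      ∀ (t : ℕ) (ht : 0 < t), t ≤ a →
        (1 / 2 : ℝ≥0∞) * poincarePlus G.normAdj (fun x y => logDist natDist x y ^ 2) ≤
          poincarePlus (G.cesaro t ht).normAdj (fun x y => logDist natDist x y ^ 2) := by
  obtain ⟨j₀, hj₀⟩ := eventually_parameters a
  filter_upwards [Filter.eventually_ge_atTop (2 ^ (2 ^ j₀))] with n hn
  have hn0 : 0 < n := (Nat.two_pow_pos _).trans_le hn
  -- the integers `m` and `j` approximate `log n` and `log log n`
  set m := Nat.log 2 n + 1 with hm
  set j := Nat.log 2 m with hj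
  have hnm : n ≤ 2 ^ m := (Nat.lt_pow_succ_log_self (by norm_num) n).le
  have hmn : 2 ^ (m - 1) ≤ n := Nat.pow_log_le_self 2 hn0.ne'
  have hjm : 2 ^ j ≤ m := Nat.pow_log_le_self 2 (by omega)
  have hmj : m < 2 ^ (j + 1) := Nat.lt_pow_succ_log_self (by norm_num) m
  have hj₀j : j₀ ≤ j := by
    have h1 : 2 ^ j₀ ≤ Nat.log 2 n := by
      calc 2 ^ j₀ = Nat.log 2 (2 ^ (2 ^ j₀)) := (Nat.log_pow (by norm_num) _).symm
        _ ≤ _ := Nat.log_mono_right hn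
    calc j₀ = Nat.log 2 (2 ^ j₀) := (Nat.log_pow (by norm_num) _).symm
      _ ≤ j := Nat.log_mono_right (by omega)
  obtain ⟨hpar1, hpar2⟩ := hj₀ j hj₀j
  obtain ⟨l, hl⟩ : ∃ l, l = Nat.log 2 (j + 6) := ⟨_, rfl⟩
  rw [← hl] at hpar2
  obtain ⟨k, hk⟩ : ∃ k, k = 16 + 2 * l := ⟨_, rfl⟩
  rw [← hk] at hpar2
  obtain ⟨D, hD⟩ : ∃ D, D = 2 ^ (j / 2) := ⟨_, rfl⟩
  rw [← hD] at hpar1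
  obtain ⟨H, hloop, hnbr, hup⟩ := exists_expander natDist natDist_self natDist_comm
    natDist_triangle hn0 hnm (by omega)
  obtain ⟨x, hx1, hxD⟩ := H.exists_embedding hloop hnbr D
  have hup' : poincarePlus H.normAdj (fun x y => logDist natDist x y ^ 2) ≤ 2 ^ k := by
    refine hup.trans ((ENNReal.ofReal_le_ofReal (expander_bound_le (j := j) (l := l) ?_ ?_)).trans
      (le_of_eq ?_))
    · have : 2 ^ (j + 5) = 2 ^ (j + 1) * 16 := by rw [pow_add 2 j 5, pow_add 2 j 1]; ring
      omega
    · rw [hl]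
      exact (Nat.lt_pow_succ_log_self (by norm_num) (j + 6)).le
    · rw [← hk, ENNReal.ofReal_pow (by norm_num), ENNReal.ofReal_ofNat]
  obtain ⟨G, hGrange, hGH, hGcase⟩ := exists_stable_or_small H
    (fun x y => logDist natDist x y ^ 2) (fun u v => natDist (x u) (x v))
    (fun u => natDist_self _) (fun u v w => natDist_triangle _ _ _) hx1
    (T := 2 ^ a) (Nat.two_pow_pos a) k
  have hlow : ENNReal.ofReal (2 * a) ≤
      poincarePlus G.normAdj (fun x y => logDist natDist x y ^ 2) := by
    refine le_trans (ENNReal.ofReal_le_ofReal ?_)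
      (RegularMultigraph.le_poincarePlus_logDist (D := D) (by simpa using hn0)
        (pow_pos (Nat.two_pow_pos a) k) hGrange fun w => ?_)
    · have hratio := le_log_div_log hpar2
      rw [← hD] at hratio
      have ha1 : (1 : ℝ) ≤ a := by exact_mod_cast ha
      nlinarith
    · rw [Fintype.card_fin]
      have h1 : 32 * m + 1 ≤ 2 ^ (j + 7) := by
        have : 2 ^ (j + 7) = 2 ^ (j + 1) * 64 := by rw [pow_add 2 j 7, pow_add 2 j 1]; ring
        omega
      calc 2 * _ ≤ 2 * (32 * m + 1) ^ D := Nat.mul_le_mul_left 2 (hxD w)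
        _ ≤ 2 * (2 ^ (j + 7)) ^ D := by gcongr
        _ = 2 ^ ((j + 7) * D + 1) := by rw [← pow_mul, pow_succ']
        _ ≤ 2 ^ (m - 1) := Nat.pow_le_pow_right (by norm_num) (by omega)
        _ ≤ n := hmn
  refine ⟨G, (hGH.trans hup').trans_lt (ENNReal.pow_lt_top ENNReal.ofNat_lt_top), ?_,
    fun t ht hta => ?_⟩
  · refine le_trans ?_ hlow
    rw [← ENNReal.ofReal_natCast]
    refine ENNReal.ofReal_le_ofReal ?_
    have : (0 : ℝ) ≤ a := Nat.cast_nonneg a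
    linarith
  -- `k` halvings would bring the constant, which is at most `2 ^ k` at the start, down to `1`
  · refine hGcase.resolve_right (fun hsmall => ?_) t ht (hta.trans Nat.lt_two_pow_self.le)
    have h1 : (2 : ℝ≥0∞) ^ k * ENNReal.ofReal (2 * a) ≤ 2 ^ k * 1 := by
      rw [mul_one]
      exact (mul_le_mul_right hlow _).trans (hsmall.trans hup')
    have h2 : ENNReal.ofReal (2 * a) ≤ 1 :=
      (ENNReal.mul_le_mul_iff_right (pow_ne_zero k two_ne_zero)
        (ENNReal.pow_ne_top ENNReal.ofNat_ne_top)).1 h1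
    rw [ENNReal.ofReal_le_one] at h2
    have ha1 : (1 : ℝ) ≤ a := by exact_mod_cast ha
    linarith

/-- A diagonal choice: `G n` is chosen to satisfy `R a n` for the largest possible `a ≤ n`. -/
lemma exists_forall_eventually {α : ℕ → Type*} (R : ℕ → ∀ n, α n → Prop)
    (hR : ∀ a b n G, a ≤ b → R b n G → R a n G) (h0 : ∀ n, ∃ G, R 0 n G)
    (h : ∀ a, ∀ᶠ n in Filter.atTop, ∃ G, R a n G) :
    ∃ G : ∀ n, α n, (∀ n, R 0 n (G n)) ∧ ∀ a, ∀ᶠ n in Filter.atTop, R a n (G n) := by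
  classical
  have hg : ∀ n, ∃ G, R (Nat.findGreatest (fun a => ∃ G, R a n G) n) n G := fun n =>
    Nat.findGreatest_spec (P := fun a => ∃ G, R a n G) (Nat.zero_le n) (h0 n)
  choose G hG using hg
  refine ⟨G, fun n => hR _ _ _ _ (Nat.zero_le _) (hG n), fun a => ?_⟩
  filter_upwards [h a, Filter.eventually_ge_atTop a] with n hn han
  exact hR _ _ _ _ (Nat.le_findGreatest han hn) (hG n)

/-! ### The absence of uniform decay -/

lemma exists_stable_family : ∃ G : ∀ n : ℕ, RegularMultigraph (Fin n),
    (∀ n : ℕ, 1 ≤ n → poincarePlus (G n).normAdj (fun x y => logDist natDist x y ^ 2) < ∞) ∧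
    Filter.Tendsto (fun n : ℕ => poincarePlus (G n).normAdj (fun x y => logDist natDist x y ^ 2))
      Filter.atTop (nhds ∞) ∧
    ∀ (t : ℕ) (ht : 0 < t), ∃ N₀ : ℕ, ∀ n : ℕ, N₀ < n →
      (1 / 2 : ℝ≥0∞) * poincarePlus (G n).normAdj (fun x y => logDist natDist x y ^ 2) ≤
        poincarePlus ((G n).cesaro t ht).normAdj (fun x y => logDist natDist x y ^ 2) := by
  obtain ⟨G, hG0, hG⟩ := exists_forall_eventually (α := fun n => RegularMultigraph (Fin n))
    (fun a n G => (1 ≤ n → poincarePlus G.normAdj (fun x y => logDist natDist x y ^ 2) < ∞) ∧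
      (a : ℝ≥0∞) ≤ poincarePlus G.normAdj (fun x y => logDist natDist x y ^ 2) ∧
      ∀ (t : ℕ) (ht : 0 < t), t ≤ a →
        (1 / 2 : ℝ≥0∞) * poincarePlus G.normAdj (fun x y => logDist natDist x y ^ 2) ≤
          poincarePlus (G.cesaro t ht).normAdj (fun x y => logDist natDist x y ^ 2))
    (fun a b n G hab h => ⟨h.1, (Nat.cast_le.2 hab).trans h.2.1,
      fun t ht hta => h.2.2 t ht (hta.trans hab)⟩)
    (fun n => by
      rcases Nat.eq_zero_or_pos n with rfl | hn
      · exact ⟨⟨fun u => u.elim0, fun u => u.elim0, 1, one_pos, fun u => u.elim0⟩,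
          fun h => by omega, by simp, fun t ht h => by omega⟩
      · obtain ⟨G, -, -, hG⟩ := exists_expander natDist natDist_self natDist_comm
          natDist_triangle hn Nat.lt_two_pow_self.le hn
        exact ⟨G, fun _ => hG.trans_lt ENNReal.ofReal_lt_top, by simp, fun t ht h => by omega⟩)
    (fun a => by
      filter_upwards [eventually_exists_stable (a + 1) a.succ_pos] with n ⟨G, h1, h2, h3⟩
      exact ⟨G, fun _ => h1, (Nat.cast_le.2 a.le_succ).trans h2,
        fun t ht hta => h3 t ht (hta.trans a.le_succ)⟩)
  refine ⟨G, fun n hn => (hG0 n).1 hn, ?_, fun t ht => ?_⟩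
  · refine ENNReal.tendsto_nhds_top fun a => ?_
    filter_upwards [hG (a + 1)] with n hn
    exact lt_of_lt_of_le (by exact_mod_cast a.lt_succ_self) hn.2.1
  · obtain ⟨N₀, hN₀⟩ := Filter.eventually_atTop.1 (hG t)
    exact ⟨N₀, fun n hn => (hN₀ n hn.le).2.2 t ht le_rfl⟩

/-- Graphs as in `exists_stable_family` contradict uniform decay with factor `3`. -/
lemma not_uniformDecay_of_stable_family {X : Type*} (K : X → X → ℝ)
    (G : ∀ n : ℕ, RegularMultigraph (Fin n))
    (hfin : ∀ n : ℕ, 1 ≤ n → poincarePlus (G n).normAdj K < ∞)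
    (hlim : Filter.Tendsto (fun n : ℕ => poincarePlus (G n).normAdj K) Filter.atTop (nhds ∞))
    (hstable : ∀ (t : ℕ) (ht : 0 < t), ∃ N₀ : ℕ, ∀ n : ℕ, N₀ < n →
      (1 / 2 : ℝ≥0∞) * poincarePlus (G n).normAdj K ≤
        poincarePlus ((G n).cesaro t ht).normAdj K) :
    ¬ UniformDecay K := by
  intro hdecay
  obtain ⟨t, ht, s₀, hs₀, h⟩ := hdecay 3 (by norm_num)
  obtain ⟨N₀, hN₀⟩ := hstable t ht
  have hev : ∀ᶠ n in Filter.atTop, ENNReal.ofReal s₀ < poincarePlus (G n).normAdj K :=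
    hlim.eventually (lt_mem_nhds ENNReal.ofReal_lt_top)
  obtain ⟨n, hn, hn1⟩ := (hev.and (Filter.eventually_gt_atTop N₀)).exists
  have h1 := h n _ (G n).isSymmStochastic_normAdj hn.le
  rw [← (G n).normAdj_cesaro t ht] at h1
  have h2 := (hN₀ n hn1).trans h1
  have htop := (hfin n (by omega)).ne
  have hpos : 0 < poincarePlus (G n).normAdj K := bot_le.trans_lt hn
  lift poincarePlus (G n).normAdj K to ℝ≥0 using htop with g
  have hg : 0 < g := by exact_mod_cast hpos
  have h3 : ENNReal.ofReal 3 = ((3 : ℝ≥0) : ℝ≥0∞) := by simp [ENNReal.ofReal]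
  have h4 : (1 / 2 : ℝ≥0∞) = ((1 / 2 : ℝ≥0) : ℝ≥0∞) := by simp
  rw [h3, h4, ← ENNReal.coe_mul, ← ENNReal.coe_div (by norm_num), ENNReal.coe_le_coe] at h2
  have h5 : (1 / 2 : ℝ) * g ≤ g / 3 := by exact_mod_cast h2
  have hg' : (0 : ℝ) < g := by exact_mod_cast hg
  linarith

theorem mainTheorem10 :
    ∃ m : MetricSpace (ℕ →₀ ℤ),
      (∀ x y : ℕ →₀ ℤ, m.dist x y = Real.log (1 + supNorm (x - y))) ∧
      (∃ G : ∀ n : ℕ, RegularMultigraph (Fin n),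
        (∀ n : ℕ, 1 ≤ n → poincarePlus (G n).normAdj (fun x y => m.dist x y ^ 2) < ∞) ∧
        Filter.Tendsto (fun n : ℕ => poincarePlus (G n).normAdj (fun x y => m.dist x y ^ 2))
          Filter.atTop (nhds ∞) ∧
        ∀ (t : ℕ) (ht : 0 < t), ∃ N₀ : ℕ, ∀ n : ℕ, N₀ < n →
          (1 / 2 : ℝ≥0∞) * poincarePlus (G n).normAdj (fun x y => m.dist x y ^ 2) ≤
            poincarePlus ((G n).cesaro t ht).normAdj (fun x y => m.dist x y ^ 2)) ∧
      ¬ UniformDecay (fun x y => m.dist x y ^ 2) := by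
  refine ⟨logMetricSpace, fun x y => ?_, exists_stable_family, ?_⟩
  · rw [supNorm_sub]
    rfl
  · obtain ⟨G, hfin, hlim, hstable⟩ := exists_stable_family
    exact not_uniformDecay_of_stable_family _ G hfin hlim hstable
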